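/- All $L^2$ spaces are complex and taken with respect to Lebesgue measure. Let $u,v:[0,1]\to[0,\infty)$ be continuous functions, each having a zero in $[0,1]$, and let $k_1,k_2:[0,1]^2\to\mathbb C$ be continuous with $k_i(x,s)=\overline{k_i(s,x)}$, such that the integral operators $(K_i\varphi)(x)=\int_0^1 k_i(x,s)\varphi(s)\,ds$ on $L^2[0,1]$ are positive, $K_i\ge 0$ ($i=1,2$). Define the bounded self-adjoint operators $$(H_1\varphi)(x)=u(x)\varphi(x)-(K_1\varphi)(x),\qquad (H_2\varphi)(x)=v(x)\varphi(x)-(K_2\varphi)(x)\qquad\text{on } L^2[0,1],$$ $$(Tf)(x,y)=(u(x)+v(y))f(x,y)-\int_0^1 k_1(x,s)f(s,y)\,ds-\int_0^1 k_2(y,t)f(x,t)\,dt\qquad\text{on } L^2([0,1]^2).$$ For a bounded self-adjoint operator $A$ let $\sigma_d(A)$ be the set of eigenvalues of finite multiplicity that are isolated points of the spectrum $\sigma(A)$, and let $\sigma_e(A)=\sigma(A)\setminus\sigma_d(A)$. Suppose that $\sigma_d(H_1)$ is infinite and that $\sigma_d(H_2)$ is finite and non-empty. Let $\beta\in\sigma_d(H_2)$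 be the left endpoint of one of the maximal segments (connected components) of $\sigma_e(T)$; that is, $\beta=S_k$ for some $k$ when $\sigma_e(T)=\bigcup_{k=1}^{n}[S_k,S_k']$ with $S_k<S_k'<S_{k+1}$. Then $T$ has the Efimov effect at $\beta$ from the left: $\beta\in\sigma_e(T)$, there is $\delta>0$ with $(\beta-\delta,\beta]\cap\sigma_e(T)=\{\beta\}$, and there is a sequence $(\omega_n)_{n\in\mathbb N}$ of eigenvalues of $T$ with $\omega_n<\beta$ for all $n$ and $\omega_n\to\beta$. -/

import Mathlib

open MeasureTheory Set Filter Topology unitInterval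
open scoped ENNReal NNReal

noncomputable section

namespace Efimov

/-! ### Spectral notions for bounded self-adjoint operators -/

section Spectral

variable {H : Type*} [NormedAddCommGroup H] [InnerProductSpace ℂ H]

/-- `lam` is an eigenvalue of `A`. -/
def IsEigenvalue (A : H →L[ℂ] H) (lam : ℝ) : Prop :=
  ∃ f : H, f ≠ 0 ∧ A f = (lam : ℂ) • f

/-- The eigenspace `ker (A - lam)`. -/
def eigenspace (A : H →L[ℂ] H) (lam : ℝ) : Submodule ℂ H :=
  Module.End.eigenspace (A : H →ₗ[ℂ] H) (lam : ℂ)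

/-- The discrete spectrum: the eigenvalues of finite multiplicity that are isolated points of the
spectrum (for self-adjoint `A` the spectrum is real). -/
def discreteSpectrum (A : H →L[ℂ] H) : Set ℝ :=
  {lam | IsEigenvalue A lam ∧ FiniteDimensional ℂ (eigenspace A lam) ∧
    ∃ δ > 0, Ioo (lam - δ) (lam + δ) ∩ spectrum ℝ A = {lam}}

/-- The essential spectrum: the complement of the discrete spectrum in the spectrum. -/
def essentialSpectrum (A : H →L[ℂ] H) : Set ℝ :=
  spectrum ℝ A \ discreteSpectrum A

/-- The Efimov effect at `lam` from the left: `lam` belongs to the essential spectrum, is isolated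
in it from the left, and is a limit of eigenvalues lying strictly to the left of `lam`. -/
def HasLeftEfimovEffect (A : H →L[ℂ] H) (lam : ℝ) : Prop :=
  lam ∈ essentialSpectrum A ∧
  (∃ δ > 0, Ioc (lam - δ) lam ∩ essentialSpectrum A = {lam}) ∧
  ∃ ω : ℕ → ℝ, (∀ n, IsEigenvalue A (ω n) ∧ ω n < lam) ∧ Tendsto ω atTop (𝓝 lam)

end Spectral

/-- `s` is the left endpoint of one of the maximal segments (connected components) of the set `E`
of real numbers. -/
def IsLeftEndpoint (E : Set ℝ) (s : ℝ) : Prop :=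
  IsLeast (connectedComponentIn E s) s

/-- If `E` is a union of finitely many disjoint segments `[S k, S' k]`, written from left to right,
then the left endpoints of `E` are exactly the numbers `S k`. -/
theorem isLeftEndpoint_iff {n : ℕ} {S S' : Fin n → ℝ} {E : Set ℝ}
    (hE : E = ⋃ k, Icc (S k) (S' k)) (hle : ∀ k, S k ≤ S' k)
    (hlt : ∀ i j, i < j → S' i < S j) (s : ℝ) :
    IsLeftEndpoint E s ↔ ∃ k, S k = s := by
  have hsub : ∀ k, Icc (S k) (S' k) ⊆ E := fun k => by
    rw [hE]; exact subset_iUnion (fun k => Icc (S k) (S' k)) k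
  constructor
  · rintro ⟨hs, hmin⟩
    have hsE := connectedComponentIn_subset _ _ hs
    rw [hE] at hsE
    obtain ⟨k, hk⟩ := mem_iUnion.1 hsE
    refine ⟨k, le_antisymm hk.1 (hmin ?_)⟩
    exact isPreconnected_Icc.subset_connectedComponentIn hk (hsub k)
      (left_mem_Icc.2 (hle k))
  · rintro ⟨k, rfl⟩
    refine ⟨mem_connectedComponentIn (hsub k (left_mem_Icc.2 (hle k))), fun y hy => ?_⟩
    by_contra! hlt'
    have h1 : ∀ᶠ m in 𝓝[<] (S k), ∀ j, j < k → S' j < m := by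
      refine eventually_all.2 fun j => ?_
      by_cases hj : j < k
      · exact (eventually_nhdsWithin_of_eventually_nhds (eventually_gt_nhds (hlt j k hj))).mono
          fun m hm _ => hm
      · exact Eventually.of_forall fun m h => absurd h hj
    have h2 : ∀ᶠ m in 𝓝[<] (S k), y < m :=
      eventually_nhdsWithin_of_eventually_nhds (eventually_gt_nhds hlt')
    obtain ⟨m, ⟨hm1, hm2⟩, hm3⟩ := ((h1.and h2).and self_mem_nhdsWithin).exists
    have hm3 : m < S k := hm3
    have hoc := (isPreconnected_connectedComponentIn (F := E) (x := S k)).ordConnected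
    have hmE : m ∈ E := connectedComponentIn_subset _ _
      (hoc.out hy (mem_connectedComponentIn (hsub k (left_mem_Icc.2 (hle k))))
        ⟨hm2.le, hm3.le⟩)
    rw [hE] at hmE
    obtain ⟨j, hj⟩ := mem_iUnion.1 hmE
    rcases lt_trichotomy j k with h | h | h
    · exact absurd hj.2 (not_le.2 (hm1 j h))
    · subst h; exact absurd hj.1 (not_le.2 hm3)
    · have := hlt k j h
      have := hle k
      linarith [hj.1]

/-! ### Multiplication and (partial) integral operators on `L²` -/

section Operators

variable {Z : Type*} [MeasurableSpace Z] {μ : Measure Z}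

/-- A transformation `Φ` of functions that is compatible with a.e. equality, a.e. linear, and
bounded in the `L²` norm with constant `C`. -/
structure IsL2Bounded (μ : Measure Z) (Φ : (Z → ℂ) → (Z → ℂ)) (C : ℝ≥0) : Prop where
  congr : ∀ f g : Z → ℂ, f =ᵐ[μ] g → Φ f =ᵐ[μ] Φ g
  add : ∀ f g : Z → ℂ, MemLp f 2 μ → MemLp g 2 μ → Φ (f + g) =ᵐ[μ] Φ f + Φ g
  smul : ∀ (c : ℂ) (f : Z → ℂ), Φ (c • f) =ᵐ[μ] c • Φ f
  meas : ∀ f : Z → ℂ, MemLp f 2 μ → AEStronglyMeasurable (Φ f) μ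
  bound : ∀ f : Z → ℂ, MemLp f 2 μ → eLpNorm (Φ f) 2 μ ≤ C * eLpNorm f 2 μ

theorem IsL2Bounded.memLp {Φ : (Z → ℂ) → (Z → ℂ)} {C : ℝ≥0} (h : IsL2Bounded μ Φ C)
    (f : Lp ℂ 2 μ) : MemLp (Φ f) 2 μ :=
  ⟨h.meas f (Lp.memLp f), (h.bound f (Lp.memLp f)).trans_lt
    (ENNReal.mul_lt_top ENNReal.coe_lt_top (Lp.memLp f).2)⟩

/-- The bounded operator on `L²` induced by `Φ`. -/
def IsL2Bounded.toCLM {Φ : (Z → ℂ) → (Z → ℂ)} {C : ℝ≥0} (h : IsL2Bounded μ Φ C) :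
    Lp ℂ 2 μ →L[ℂ] Lp ℂ 2 μ :=
  LinearMap.mkContinuous
    { toFun := fun f => (h.memLp f).toLp (Φ f)
      map_add' := fun f g => by
        refine Lp.ext ?_
        filter_upwards [(h.memLp (f + g)).coeFn_toLp, (h.memLp f).coeFn_toLp,
          (h.memLp g).coeFn_toLp, h.congr _ _ (Lp.coeFn_add f g),
          h.add f g (Lp.memLp f) (Lp.memLp g),
          Lp.coeFn_add ((h.memLp f).toLp (Φ f)) ((h.memLp g).toLp (Φ g))] with z h1 h2 h3 h4 h5 h6
        rw [h1, h6, h4, h5, Pi.add_apply, Pi.add_apply, h2, h3]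
      map_smul' := fun c f => by
        refine Lp.ext ?_
        filter_upwards [(h.memLp (c • f)).coeFn_toLp, (h.memLp f).coeFn_toLp,
          h.congr _ _ (Lp.coeFn_smul c f), h.smul c f,
          Lp.coeFn_smul c ((h.memLp f).toLp (Φ f))] with z h1 h2 h3 h4 h5
        simp only [RingHom.id_apply]
        rw [h1, h5, h3, h4, Pi.smul_apply, Pi.smul_apply, h2] }
    C fun f => by
      simp only [LinearMap.coe_mk, AddHom.coe_mk]
      rw [Lp.norm_toLp, Lp.norm_def]
      have := ENNReal.toReal_mono
        (ENNReal.mul_lt_top ENNReal.coe_lt_top (Lp.memLp f).2).ne (h.bound f (Lp.memLp f))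
      simpa using this

theorem IsL2Bounded.toCLM_coe {Φ : (Z → ℂ) → (Z → ℂ)} {C : ℝ≥0} (h : IsL2Bounded μ Φ C)
    (f : Lp ℂ 2 μ) : h.toCLM f =ᵐ[μ] Φ f :=
  (h.memLp f).coeFn_toLp

variable [TopologicalSpace Z] [CompactSpace Z] [OpensMeasurableSpace Z]

theorem isL2Bounded_mul (μ : Measure Z) (g : C(Z, ℝ)) :
    IsL2Bounded μ (fun f z => (g z : ℂ) * f z) ‖g‖₊ where
  congr f f' h := by filter_upwards [h] with z hz; rw [hz]
  add f f' _ _ := Eventually.of_forall fun z => by simp [mul_add]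
  smul c f := Eventually.of_forall fun z => by simp; ring
  meas f hf := by
    have : Continuous fun z => (g z : ℂ) := by fun_prop
    exact this.aestronglyMeasurable.mul hf.1
  bound f hf := by
    have := eLpNorm_le_nnreal_smul_eLpNorm_of_ae_le_mul (μ := μ)
      (f := fun z => (g z : ℂ) * f z) (g := f) (c := ‖g‖₊) (Eventually.of_forall fun z => by
        rw [nnnorm_mul]
        gcongr
        have := g.norm_coe_le_norm z
        rw [← NNReal.coe_le_coe]
        simpa using this) 2
    simpa [ENNReal.smul_def] using this

/-- Multiplication by a continuous real function `g`. -/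
def mulOp (μ : Measure Z) (g : C(Z, ℝ)) : Lp ℂ 2 μ →L[ℂ] Lp ℂ 2 μ :=
  (isL2Bounded_mul μ g).toCLM

theorem mulOp_coe (g : C(Z, ℝ)) (f : Lp ℂ 2 μ) :
    mulOp μ g f =ᵐ[μ] fun z => (g z : ℂ) * f z :=
  (isL2Bounded_mul μ g).toCLM_coe f

theorem isL2Bounded_integral (μ : Measure Z) [IsProbabilityMeasure μ] (κ : C(Z × I, ℂ))
    {τ : Z × I → Z} (hτ : MeasurePreserving τ (μ.prod volume) μ) :
    IsL2Bounded μ (fun f z => ∫ s, κ (z, s) * f (τ (z, s))) ‖κ‖₊ where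
  congr f g h := by
    have h' := hτ.quasiMeasurePreserving.ae_eq_comp h
    filter_upwards [Measure.ae_ae_of_ae_prod h'] with z hz
    refine integral_congr_ae ?_
    filter_upwards [hz] with s hs
    simp only [Function.comp] at hs
    rw [hs]
  add f g hf hg := by
    have key : ∀ f : Z → ℂ, MemLp f 2 μ →
        ∀ᵐ z ∂μ, Integrable (fun s => κ (z, s) * f (τ (z, s))) volume := by
      intro f hf
      have h1 : MemLp (f ∘ τ) 2 (μ.prod volume) := hf.comp_measurePreserving hτ
      have h2 : Integrable (f ∘ τ) (μ.prod volume) := h1.integrable (by norm_num)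
      have h3 : Integrable (fun p => κ p * f (τ p)) (μ.prod volume) :=
        h2.bdd_mul (c := ‖κ‖) κ.continuous.aestronglyMeasurable
          (Eventually.of_forall fun p => κ.norm_coe_le_norm p)
      exact h3.prod_right_ae
    filter_upwards [key f hf, key g hg] with z h1 h2
    simp only [Pi.add_apply, mul_add]
    exact integral_add h1 h2
  smul c f := Eventually.of_forall fun z => by
    simp only [Pi.smul_apply, smul_eq_mul]
    rw [← integral_const_mul]
    congr 1; ext s; ring
  meas f hf := by
    have h1 : AEStronglyMeasurable (fun p => κ p * f (τ p)) (μ.prod volume) :=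
      κ.continuous.aestronglyMeasurable.mul (hf.1.comp_measurePreserving hτ)
    exact h1.integral_prod_right'
  bound f hf := by
    have hm : AEStronglyMeasurable (f ∘ τ) (μ.prod volume) := hf.1.comp_measurePreserving hτ
    have hsl : ∀ᵐ z ∂μ, AEStronglyMeasurable (fun s => f (τ (z, s))) (volume : Measure I) :=
      hm.prodMk_left
    have hpt : ∀ᵐ z ∂μ, ‖∫ s, κ (z, s) * f (τ (z, s))‖ₑ ^ (2 : ℝ) ≤
        (‖κ‖₊ : ℝ≥0∞) ^ (2 : ℝ) * ∫⁻ s, ‖f (τ (z, s))‖ₑ ^ (2 : ℝ) := by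
      filter_upwards [hsl] with z hz
      have h1 : ‖∫ s, κ (z, s) * f (τ (z, s))‖ₑ ≤
          (‖κ‖₊ : ℝ≥0∞) * eLpNorm (fun s => f (τ (z, s))) 1 (volume : Measure I) := by
        refine (enorm_integral_le_lintegral_enorm _).trans ?_
        rw [eLpNorm_one_eq_lintegral_enorm, ← lintegral_const_mul' _ _ ENNReal.coe_ne_top]
        refine lintegral_mono fun s => ?_
        rw [enorm_mul]
        gcongr
        rw [enorm_eq_nnnorm]
        exact ENNReal.coe_le_coe.2 (κ.norm_coe_le_norm (z, s))
      have h2 := eLpNorm_le_eLpNorm_of_exponent_le (μ := (volume : Measure I))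
        (p := 1) (q := 2) (by norm_num) hz
      have h3 := ENNReal.rpow_le_rpow (h1.trans (mul_le_mul_right h2 _))
        (show (0 : ℝ) ≤ 2 by norm_num)
      refine h3.trans (le_of_eq ?_)
      rw [ENNReal.mul_rpow_of_nonneg _ _ (by norm_num),
        eLpNorm_eq_lintegral_rpow_enorm_toReal (by norm_num) (by norm_num), ← ENNReal.rpow_mul]
      norm_num
    have hint : ∫⁻ z, ∫⁻ s, ‖f (τ (z, s))‖ₑ ^ (2 : ℝ) ∂(volume : Measure I) ∂μ =
        ∫⁻ z, ‖f z‖ₑ ^ (2 : ℝ) ∂μ := by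
      rw [← lintegral_prod (fun p => ‖f (τ p)‖ₑ ^ (2 : ℝ)) (hm.enorm.pow_const _)]
      rw [← hτ.map_eq, lintegral_map' _ hτ.aemeasurable, hτ.map_eq]
      rw [hτ.map_eq]
      exact hf.1.enorm.pow_const _
    rw [eLpNorm_eq_lintegral_rpow_enorm_toReal (by norm_num) (by norm_num),
      eLpNorm_eq_lintegral_rpow_enorm_toReal (by norm_num) (by norm_num)]
    simp only [ENNReal.toReal_ofNat]
    have h4 := lintegral_mono_ae hpt
    rw [lintegral_const_mul' _ _ (by simp), hint] at h4
    have h5 := ENNReal.rpow_le_rpow h4 (show (0 : ℝ) ≤ 1 / 2 by norm_num)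
    rw [ENNReal.mul_rpow_of_nonneg _ _ (by norm_num), ← ENNReal.rpow_mul] at h5
    norm_num at h5 ⊢
    exact h5

/-- The operator `f ↦ (z ↦ ∫ κ(z, s) f(τ(z, s)) ds)` on `L²`. -/
def integralOp (μ : Measure Z) [IsProbabilityMeasure μ] (κ : C(Z × I, ℂ))
    {τ : Z × I → Z} (hτ : MeasurePreserving τ (μ.prod volume) μ) :
    Lp ℂ 2 μ →L[ℂ] Lp ℂ 2 μ :=
  (isL2Bounded_integral μ κ hτ).toCLM

theorem integralOp_coe [IsProbabilityMeasure μ] (κ : C(Z × I, ℂ))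
    {τ : Z × I → Z} (hτ : MeasurePreserving τ (μ.prod volume) μ) (f : Lp ℂ 2 μ) :
    integralOp μ κ hτ f =ᵐ[μ] fun z => ∫ s, κ (z, s) * f (τ (z, s)) :=
  (isL2Bounded_integral μ κ hτ).toCLM_coe f

end Operators

/-! ### The model -/

/-- `L²[0,1]` (complex, Lebesgue measure). -/
abbrev L2 : Type := Lp ℂ 2 (volume : Measure I)

/-- `L²([0,1]²)`. -/
abbrev L2sq : Type := Lp ℂ 2 (volume : Measure (I × I))

theorem measurePreserving_one :
    MeasurePreserving (fun p : I × I => p.2) ((volume : Measure I).prod volume) volume :=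
  measurePreserving_snd

theorem measurePreserving_fst_var :
    MeasurePreserving (fun p : (I × I) × I => (p.2, p.1.2))
      ((volume : Measure (I × I)).prod volume) volume := by
  have h1 : MeasurePreserving (Prod.map Prod.snd id : (I × I) × I → I × I)
      ((volume : Measure (I × I)).prod volume) ((volume : Measure I).prod volume) :=
    MeasurePreserving.prod measurePreserving_snd (MeasurePreserving.id _)
  exact Measure.measurePreserving_swap.comp h1

theorem measurePreserving_snd_var :
    MeasurePreserving (fun p : (I × I) × I => (p.1.1, p.2))
      ((volume : Measure (I × I)).prod volume) volume := by
  have h1 : MeasurePreserving (Prod.map Prod.fst id : (I × I) × I → I × I)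
      ((volume : Measure (I × I)).prod volume) ((volume : Measure I).prod volume) :=
    MeasurePreserving.prod measurePreserving_fst (MeasurePreserving.id _)
  exact h1

/-- The integral operator `(K φ)(x) = ∫ k(x, s) φ(s) ds` on `L²[0,1]`. -/
def opK (k : C(I × I, ℂ)) : L2 →L[ℂ] L2 :=
  integralOp volume k measurePreserving_one

theorem opK_coe (k : C(I × I, ℂ)) (φ : L2) :
    opK k φ =ᵐ[volume] fun x => ∫ s, k (x, s) * φ s :=
  integralOp_coe k measurePreserving_one φ

/-- The operator `H = U - K` of the Friedrichs model on `L²[0,1]`: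
`(H φ)(x) = u(x) φ(x) - ∫ k(x, s) φ(s) ds`. -/
def opH (u : C(I, ℝ)) (k : C(I × I, ℂ)) : L2 →L[ℂ] L2 :=
  mulOp volume u - opK k

/-- `(T₀ f)(x, y) = (u(x) + v(y)) f(x, y)`. -/
def opT0 (u v : C(I, ℝ)) : L2sq →L[ℂ] L2sq :=
  mulOp volume (u.comp ContinuousMap.fst + v.comp ContinuousMap.snd)

theorem opT0_coe (u v : C(I, ℝ)) (f : L2sq) :
    opT0 u v f =ᵐ[volume] fun z => ((u z.1 + v z.2 : ℝ) : ℂ) * f z :=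
  mulOp_coe _ f

/-- `(T₁ f)(x, y) = ∫ k₁(x, s) f(s, y) ds`. -/
def opT1 (k₁ : C(I × I, ℂ)) : L2sq →L[ℂ] L2sq :=
  integralOp volume (k₁.comp ⟨fun p : (I × I) × I => (p.1.1, p.2), by fun_prop⟩)
    measurePreserving_fst_var

theorem opT1_coe (k₁ : C(I × I, ℂ)) (f : L2sq) :
    opT1 k₁ f =ᵐ[volume] fun z => ∫ s, k₁ (z.1, s) * f (s, z.2) :=
  integralOp_coe _ measurePreserving_fst_var f

/-- `(T₂ f)(x, y) = ∫ k₂(y, t) f(x, t) dt`. -/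
def opT2 (k₂ : C(I × I, ℂ)) : L2sq →L[ℂ] L2sq :=
  integralOp volume (k₂.comp ⟨fun p : (I × I) × I => (p.1.2, p.2), by fun_prop⟩)
    measurePreserving_snd_var

theorem opT2_coe (k₂ : C(I × I, ℂ)) (f : L2sq) :
    opT2 k₂ f =ᵐ[volume] fun z => ∫ t, k₂ (z.2, t) * f (z.1, t) :=
  integralOp_coe _ measurePreserving_snd_var f

/-- The three-particle discrete Schrödinger operator `T = T₀ - (T₁ + T₂)` on `L²([0,1]²)`. -/
def opT (u v : C(I, ℝ)) (k₁ k₂ : C(I × I, ℂ)) : L2sq →L[ℂ] L2sq :=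
  opT0 u v - (opT1 k₁ + opT2 k₂)

end Efimov

end

noncomputable section

namespace Efimov

open scoped InnerProductSpace

/-! ### Lower bounds, resolvent points and essential spectrum of symmetric operators. -/

section AbstractSpectral

variable {H : Type*} [NormedAddCommGroup H] [InnerProductSpace ℂ H]

/-! The operator `T` is `H₁ ⊗ 1 + 1 ⊗ H₂` (`opT_tensor`). Since `u, v ≥ 0` and `K₁, K₂` are compact,
below any `c < 0` each `Hᵢ` has only finitely many eigenvalues, counted with multiplicity, and its
form is at least `c` on the orthogonal complement of their eigenvectors
(`nonempty_lowerEigenfamily`). Hence an infinite discrete spectrum of `H₁` yields negative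
eigenvalues `λ_n → 0`, and `λ_n + β` are eigenvalues of `T` with product eigenfunctions, lying below
`β` and tending to `β`.

Isolation from the left uses the segments `[l, l + max v]` and `[m, m + max u]`, where `l`, `m` are
negative eigenvalues of `H₁`, `H₂`. A negative `E` outside all of them is not in the essential
spectrum (`IsHilbertTensor.notMem_essentialSpectrum`): off finitely many product eigenvectors, `T -
E` is bounded below block by block. Conversely, each segment lies in the spectrum of `T`, because
the values of `u` and `v` lie in the spectra of `H₁` and `H₂` (`mem_spectrum_opH`). A segment
starting left of `β` and reaching `β` would be nondegenerate, hence essential spectrum, and `β`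
would not be a left endpoint (`lt_of_isLeftEndpoint`). Only finitely many segments start left of
`β`, so all of these end at a positive distance below `β`.

Finally `β < 0`: otherwise `v = 0` and `β = 0`, and an isolated eigenvalue `0` of finite
multiplicity for `-K₂` would make `L²[0,1]` finite-dimensional, contradicting the infinite discrete
spectrum of `H₁`. -/

theorem norm_add_sq_of_inner_eq_zero {x y : H} (h : ⟪x, y⟫_ℂ = 0) :
    ‖x + y‖ ^ 2 = ‖x‖ ^ 2 + ‖y‖ ^ 2 := by
  have := norm_add_sq_eq_norm_sq_add_norm_sq_of_inner_eq_zero x y h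
  nlinarith

theorem re_inner_self (x : H) : (⟪x, x⟫_ℂ).re = ‖x‖ ^ 2 := by
  rw [inner_self_eq_norm_sq_to_K]
  simp [← Complex.ofReal_pow]

theorem re_inner_sub_smul (A : H →L[ℂ] H) (c : ℝ) (f : H) :
    (⟪A f - (c : ℂ) • f, f⟫_ℂ).re = (⟪A f, f⟫_ℂ).re - c * ‖f‖ ^ 2 := by
  rw [inner_sub_left, inner_smul_left, inner_self_eq_norm_sq_to_K]
  simp [← Complex.ofReal_pow]

theorem le_norm_of_le_re_inner {c : ℝ} {f g : H} (h : c * ‖f‖ ^ 2 ≤ (⟪g, f⟫_ℂ).re) :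
    c * ‖f‖ ≤ ‖g‖ := by
  rcases (norm_nonneg f).eq_or_lt with h0 | h0
  · rw [← h0]; simp
  · have h1 : (⟪g, f⟫_ℂ).re ≤ ‖g‖ * ‖f‖ := re_inner_le_norm (𝕜 := ℂ) g f
    have h2 : (c * ‖f‖) * ‖f‖ ≤ ‖g‖ * ‖f‖ := by nlinarith
    exact le_of_mul_le_mul_right h2 h0

/-- Working with a neighbourhood filter instead of a minimum also covers an empty index type, which
occurs when there are no eigenvectors. -/
theorem exists_pos_forall_le {ι : Type*} [Finite ι] (a : ι → ℝ) (ha : ∀ i, 0 < a i) :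
    ∃ c > 0, ∀ i, c ≤ a i := by
  have h : ∀ᶠ c in 𝓝[>] (0 : ℝ), ∀ i, c ≤ a i := eventually_all.2 fun i =>
    eventually_nhdsWithin_of_eventually_nhds (eventually_le_nhds (ha i))
  obtain ⟨c, hc, hpos⟩ := (h.and self_mem_nhdsWithin).exists
  exact ⟨c, hpos, hc⟩

theorem antilipschitz_of_le_norm {E F : Type*} [NormedAddCommGroup E] [NormedSpace ℂ E]
    [NormedAddCommGroup F] [NormedSpace ℂ F] (R : E →L[ℂ] F) {c : ℝ}
    (hc : 0 < c) (h : ∀ f, c * ‖f‖ ≤ ‖R f‖) : ∃ K : ℝ≥0, AntilipschitzWith K R := by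
  refine ⟨⟨c⁻¹, by positivity⟩, R.antilipschitz_of_bound fun f => ?_⟩
  change ‖f‖ ≤ c⁻¹ * ‖R f‖
  rw [inv_mul_eq_div, le_div_iff₀ hc, mul_comm]
  exact h f

theorem isSymmetric_sub_smul {A : H →L[ℂ] H} (hA : (A : H →ₗ[ℂ] H).IsSymmetric) (c : ℝ) (f g : H) :
    ⟪A f - (c : ℂ) • f, g⟫_ℂ = ⟪f, A g - (c : ℂ) • g⟫_ℂ := by
  have := hA f g
  simp only [ContinuousLinearMap.coe_coe] at this
  rw [inner_sub_left, inner_sub_right, this, inner_smul_left, inner_smul_right]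
  simp

theorem exists_le_norm_of_notMem_spectrum {A : H →L[ℂ] H} {lam : ℝ} (h : lam ∉ spectrum ℝ A) :
    ∃ c > 0, ∀ f, c * ‖f‖ ≤ ‖A f - (lam : ℂ) • f‖ := by
  rw [spectrum.mem_iff, not_not] at h
  obtain ⟨w, hw⟩ := h
  have hR : ∀ f, (algebraMap ℝ (H →L[ℂ] H) lam - A) f = -(A f - (lam : ℂ) • f) := by
    intro f
    rw [_root_.sub_apply, Algebra.algebraMap_eq_smul_one]
    simp
  set S : H →L[ℂ] H := ↑w⁻¹
  refine ⟨(‖S‖ + 1)⁻¹, by positivity, fun f => ?_⟩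
  have h1 : S ((algebraMap ℝ (H →L[ℂ] H) lam - A) f) = f := by
    rw [← hw]
    exact congrArg (fun X : H →L[ℂ] H => X f) w.inv_mul
  have h2 : ‖f‖ ≤ ‖S‖ * ‖A f - (lam : ℂ) • f‖ := by
    have := S.le_opNorm ((algebraMap ℝ (H →L[ℂ] H) lam - A) f)
    rwa [h1, hR, norm_neg] at this
  rw [inv_mul_le_iff₀ (by positivity)]
  nlinarith [norm_nonneg (A f - (lam : ℂ) • f)]

theorem mem_spectrum_of_isEigenvalue {A : H →L[ℂ] H} {lam : ℝ} (h : IsEigenvalue A lam) :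
    lam ∈ spectrum ℝ A := by
  by_contra hn
  obtain ⟨c, hc, hb⟩ := exists_le_norm_of_notMem_spectrum hn
  obtain ⟨f, hf, hAf⟩ := h
  have := hb f
  rw [hAf, sub_self, norm_zero] at this
  have h2 : 0 < ‖f‖ := norm_pos_iff.2 hf
  nlinarith

section Complete

variable [CompleteSpace H]

/-- The lower bound gives injectivity and closed range; by symmetry, a vector orthogonal to the
range lies in the kernel, so the range is dense. -/
theorem notMem_spectrum_of_le_norm {A : H →L[ℂ] H} (hA : (A : H →ₗ[ℂ] H).IsSymmetric) {lam c : ℝ}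
    (hc : 0 < c) (h : ∀ f, c * ‖f‖ ≤ ‖A f - (lam : ℂ) • f‖) : lam ∉ spectrum ℝ A := by
  rw [spectrum.mem_iff, not_not]
  have hR : ∀ f, (algebraMap ℝ (H →L[ℂ] H) lam - A) f = -(A f - (lam : ℂ) • f) := by
    intro f
    rw [_root_.sub_apply, Algebra.algebraMap_eq_smul_one]
    simp
  have hb : ∀ f, c * ‖f‖ ≤ ‖(algebraMap ℝ (H →L[ℂ] H) lam - A) f‖ := fun f => by
    rw [hR, norm_neg]; exact h f
  rw [ContinuousLinearMap.isUnit_iff_bijective,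
    ContinuousLinearMap.bijective_iff_dense_range_and_antilipschitz]
  refine ⟨?_, antilipschitz_of_le_norm _ hc hb⟩
  rw [Submodule.topologicalClosure_eq_top_iff, Submodule.eq_bot_iff]
  intro x hx
  have h0 : A x - (lam : ℂ) • x = 0 := by
    refine ext_inner_left ℂ fun y => ?_
    rw [← isSymmetric_sub_smul hA, inner_zero_right]
    have := hx _ ⟨y, rfl⟩
    rw [ContinuousLinearMap.coe_coe, hR, inner_neg_left, neg_eq_zero] at this
    exact this
  have h1 := h x
  rw [h0, norm_zero] at h1
  have h2 : ‖x‖ ≤ 0 := by nlinarith [norm_nonneg x]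
  simpa using h2

end Complete

/-- The norm of a finite combination of orthonormal vectors. -/
theorem _root_.Orthonormal.norm_sq_sum_smul {ι : Type*} [Fintype ι] {χ : ι → H}
    (hχ : Orthonormal ℂ χ) (a : ι → ℂ) : ‖∑ i, a i • χ i‖ ^ 2 = ∑ i, ‖a i‖ ^ 2 := by
  have h := hχ.inner_sum a a Finset.univ
  have h2 : ((‖∑ i, a i • χ i‖ ^ 2 : ℝ) : ℂ) = ((∑ i, ‖a i‖ ^ 2 : ℝ) : ℂ) := by
    rw [Complex.ofReal_pow, ← Complex.coe_algebraMap, ← inner_self_eq_norm_sq_to_K (𝕜 := ℂ), h]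
    push_cast
    exact Finset.sum_congr rfl fun i _ => Complex.conj_mul' _
  exact_mod_cast h2

section EigenFamily

variable {ι : Type*} [Fintype ι] {χ : ι → H}

theorem inner_sub_sum_eq_zero (hχ : Orthonormal ℂ χ) (f : H) (i : ι) :
    ⟪χ i, f - ∑ k, ⟪χ k, f⟫_ℂ • χ k⟫_ℂ = 0 := by
  rw [inner_sub_right, hχ.inner_right_fintype, sub_self]

/-- The span of the eigenvectors and its complement are both invariant, so Pythagoras applies to `f`
and to `(T - E) f` in the same splitting. -/
theorem norm_sq_sub_smul_of_eigen {T : H →L[ℂ] H} (hT : (T : H →ₗ[ℂ] H).IsSymmetric)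
    (hχ : Orthonormal ℂ χ) {ν : ι → ℝ} (hν : ∀ i, T (χ i) = (ν i : ℂ) • χ i) (E : ℝ) (f w : H)
    (hw : w = f - ∑ k, ⟪χ k, f⟫_ℂ • χ k) :
    ‖f‖ ^ 2 = ∑ k, ‖⟪χ k, f⟫_ℂ‖ ^ 2 + ‖w‖ ^ 2 ∧
    ‖T f - (E : ℂ) • f‖ ^ 2 =
      ∑ k, (ν k - E) ^ 2 * ‖⟪χ k, f⟫_ℂ‖ ^ 2 + ‖T w - (E : ℂ) • w‖ ^ 2 := by
  have hperp : ∀ i, ⟪χ i, w⟫_ℂ = 0 := fun i => by rw [hw]; exact inner_sub_sum_eq_zero hχ f i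
  have hf : f = (∑ k, ⟪χ k, f⟫_ℂ • χ k) + w := by rw [hw]; abel
  have hT' : T f - (E : ℂ) • f =
      (∑ k, ((((ν k - E : ℝ)) : ℂ) * ⟪χ k, f⟫_ℂ) • χ k) + (T w - (E : ℂ) • w) := by
    conv_lhs => rw [hf]
    rw [map_add, map_sum, smul_add, Finset.smul_sum, add_sub_add_comm, ← Finset.sum_sub_distrib]
    congr 1
    refine Finset.sum_congr rfl fun k _ => ?_
    rw [map_smul, hν, smul_smul, smul_smul, ← sub_smul]
    congr 1
    push_cast; ring
  constructor
  · conv_lhs => rw [hf]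
    rw [norm_add_sq_of_inner_eq_zero, hχ.norm_sq_sum_smul]
    rw [sum_inner]
    refine Finset.sum_eq_zero fun k _ => ?_
    rw [inner_smul_left, hperp, mul_zero]
  · rw [hT', norm_add_sq_of_inner_eq_zero, hχ.norm_sq_sum_smul]
    · congr 1
      refine Finset.sum_congr rfl fun k _ => ?_
      rw [norm_mul, mul_pow, Complex.norm_real, Real.norm_eq_abs, sq_abs]
    · rw [sum_inner]
      refine Finset.sum_eq_zero fun k _ => ?_
      rw [inner_smul_left, ← isSymmetric_sub_smul hT, hν, ← sub_smul, inner_smul_left, hperp]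
      simp

variable [CompleteSpace H]

/-- If `T - E` is bounded below off the span of finitely many eigenvectors, then `E` does not
belong to the essential spectrum. -/
theorem notMem_essentialSpectrum_of_le_norm {T : H →L[ℂ] H} (hT : (T : H →ₗ[ℂ] H).IsSymmetric)
    (hχ : Orthonormal ℂ χ) {ν : ι → ℝ} (hν : ∀ i, T (χ i) = (ν i : ℂ) • χ i) {E ε : ℝ}
    (hε : 0 < ε) (h : ∀ f, (∀ i, ⟪χ i, f⟫_ℂ = 0) → ε * ‖f‖ ≤ ‖T f - (E : ℂ) • f‖) :
    E ∉ essentialSpectrum T := by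
  -- Off the span the given bound survives a shift of `E` by less than `ε`; on the span `T - E'` is
  -- diagonal with nonzero entries.
  have key : ∀ E' : ℝ, |E' - E| < ε → (∀ i, ν i ≠ E') → E' ∉ spectrum ℝ T := by
    intro E' hE' hne
    obtain ⟨c, hc, hcν⟩ := exists_pos_forall_le (fun i => |ν i - E'|)
      fun i => abs_pos.2 (sub_ne_zero.2 (hne i))
    set d := min c (ε - |E' - E|)
    have hd : 0 < d := lt_min hc (by linarith)
    refine notMem_spectrum_of_le_norm hT hd fun f => ?_
    obtain ⟨h1, h2⟩ := norm_sq_sub_smul_of_eigen hT hχ hν E' f _ rfl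
    set w := f - ∑ k, ⟪χ k, f⟫_ℂ • χ k with hw
    have hw' : d * ‖w‖ ≤ ‖T w - (E' : ℂ) • w‖ := by
      have h3 := h w (inner_sub_sum_eq_zero hχ f)
      have h4 : T w - (E : ℂ) • w = (T w - (E' : ℂ) • w) + ((E' - E : ℝ) : ℂ) • w := by
        push_cast; rw [sub_smul]; abel
      have h5 := norm_add_le (T w - (E' : ℂ) • w) (((E' - E : ℝ) : ℂ) • w)
      rw [← h4, norm_smul, Complex.norm_real, Real.norm_eq_abs] at h5
      have h6 : d ≤ ε - |E' - E| := min_le_right _ _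
      nlinarith [norm_nonneg w]
    refine abs_le_of_sq_le_sq' ?_ (norm_nonneg _) |>.2
    rw [mul_pow, h1, h2, mul_add, Finset.mul_sum, ← mul_pow]
    refine add_le_add (Finset.sum_le_sum fun k _ => ?_) ?_
    · refine mul_le_mul_of_nonneg_right ?_ (by positivity)
      rw [← sq_abs (ν k - E')]
      exact pow_le_pow_left₀ hd.le ((min_le_left _ _).trans (hcν k)) 2
    · exact pow_le_pow_left₀ (by positivity) hw' 2
  intro hess
  by_cases hE : ∃ i, ν i = E
  · obtain ⟨i, hi⟩ := hE
    refine hess.2 ⟨⟨χ i, hχ.ne_zero i, by rw [hν, hi]⟩, ?_, ?_⟩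
    -- The component of an `E`-eigenvector off the span is annihilated by `T - E`, hence zero by the
    -- lower bound.
    · have hle : eigenspace T E ≤ Submodule.span ℂ (range χ) := by
        intro f hf
        have hf' : T f = (E : ℂ) • f := Module.End.mem_eigenspace_iff.1 hf
        obtain ⟨-, h2⟩ := norm_sq_sub_smul_of_eigen hT hχ hν E f _ rfl
        have h3 := h _ (inner_sub_sum_eq_zero hχ f)
        set w := f - ∑ k, ⟪χ k, f⟫_ℂ • χ k with hw
        rw [hf', sub_self, norm_zero] at h2
        have h4 : 0 ≤ ∑ k, (ν k - E) ^ 2 * ‖⟪χ k, f⟫_ℂ‖ ^ 2 :=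
          Finset.sum_nonneg fun k _ => by positivity
        have h5 : ‖T w - (E : ℂ) • w‖ = 0 := by
          have : ‖T w - (E : ℂ) • w‖ ^ 2 ≤ 0 := by nlinarith
          nlinarith [norm_nonneg (T w - (E : ℂ) • w)]
        have h6 : ‖w‖ ≤ 0 := by rw [h5] at h3; nlinarith [norm_nonneg w]
        have h7 : f = ∑ k, ⟪χ k, f⟫_ℂ • χ k := sub_eq_zero.1 (norm_le_zero_iff.1 h6)
        rw [h7]
        exact Submodule.sum_mem _ fun k _ =>
          Submodule.smul_mem _ _ (Submodule.subset_span ⟨k, rfl⟩)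
      have : FiniteDimensional ℂ (Submodule.span ℂ (range χ)) :=
        FiniteDimensional.span_of_finite ℂ (finite_range χ)
      exact Submodule.finiteDimensional_of_le hle
    · obtain ⟨c, hc, hcν⟩ := exists_pos_forall_le (fun i => if ν i = E then 1 else |ν i - E|)
        fun i => by
          split_ifs with h
          · exact one_pos
          · exact abs_pos.2 (sub_ne_zero.2 h)
      refine ⟨min c ε, lt_min hc hε, Subset.antisymm ?_ ?_⟩
      · rintro E' ⟨hE', hsp⟩
        by_contra hne
        have habs : |E' - E| < min c ε := abs_lt.2 ⟨by linarith [hE'.1], by linarith [hE'.2]⟩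
        refine key E' (habs.trans_le (min_le_right _ _)) (fun j hj => ?_) hsp
        have := hcν j
        rw [hj, if_neg (show E' ≠ E from hne)] at this
        exact absurd (habs.trans_le (min_le_left _ _)) (not_lt.2 this)
      · rintro _ rfl
        have := lt_min hc hε
        exact ⟨⟨by linarith, by linarith⟩, hess.1⟩
  · push Not at hE
    exact key E (by simpa using hε) hE hess.1

end EigenFamily

end AbstractSpectral

/-! ### Negative eigenvalues of a compact perturbation of a nonnegative operator. -/

section CompactPerturbation

variable {H : Type*} [NormedAddCommGroup H] [InnerProductSpace ℂ H]

/-- A compact operator that is bounded below on a subspace forces the subspace to be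
finite-dimensional. -/
theorem finiteDimensional_of_le_norm [CompleteSpace H] {K : H →L[ℂ] H} (hK : IsCompactOperator K)
    {V : Submodule ℂ H} {c : ℝ} (hc : 0 < c) (h : ∀ f ∈ V, c * ‖f‖ ≤ ‖K f‖) :
    FiniteDimensional ℂ V := by
  -- On the closure the operator becomes a closed embedding that is also compact, so the unit ball
  -- is compact and Riesz's theorem applies.
  have hcl : ∀ f ∈ V.topologicalClosure, c * ‖f‖ ≤ ‖K f‖ := by
    have hclosed : IsClosed {f : H | c * ‖f‖ ≤ ‖K f‖} :=
      isClosed_le (by fun_prop) (by fun_prop)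
    exact fun f hf => closure_minimal (fun f hf => h f hf) hclosed hf
  set W := V.topologicalClosure
  have : CompleteSpace W := V.isClosed_topologicalClosure.completeSpace_coe
  obtain ⟨C, hC⟩ := antilipschitz_of_le_norm (K.comp W.subtypeL) hc
    fun f => by simpa using hcl f f.2
  have hemb := hC.isClosedEmbedding (K.comp W.subtypeL).uniformContinuous
  have hcomp : IsCompactOperator (K.comp W.subtypeL) := hK.comp_clm W.subtypeL
  have h1 := hemb.isCompact_preimage (hcomp.isCompact_closure_image_closedBall 1)
  have h2 : IsCompact (Metric.closedBall (0 : W) 1) :=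
    h1.of_isClosed_subset Metric.isClosed_closedBall fun x hx =>
      subset_closure (mem_image_of_mem _ hx)
  have : FiniteDimensional ℂ W := .of_isCompact_closedBall₀ ℂ one_pos h2
  exact Submodule.finiteDimensional_of_le V.le_topologicalClosure

/-- The span of the eigenvectors whose eigenvalues are at most `c`. -/
def lowerSubmodule (A : H →L[ℂ] H) (c : ℝ) : Submodule ℂ H :=
  ⨆ l : Iic c, eigenspace A l

theorem mem_lowerSubmodule {A : H →L[ℂ] H} {c l : ℝ} (hl : l ≤ c) {f : H}
    (hf : A f = (l : ℂ) • f) : f ∈ lowerSubmodule A c :=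
  Submodule.mem_iSup_of_mem (p := fun l : Iic c => eigenspace A l) ⟨l, hl⟩
    (Module.End.mem_eigenspace_iff.2 hf)

theorem map_mem_lowerSubmodule {A : H →L[ℂ] H} {c : ℝ} {f : H} (hf : f ∈ lowerSubmodule A c) :
    A f ∈ lowerSubmodule A c := by
  refine Submodule.iSup_induction (fun l : Iic c => eigenspace A l)
    (motive := fun f => A f ∈ lowerSubmodule A c) hf ?_ ?_ ?_
  · intro l f hf
    have h : A f = ((l : ℝ) : ℂ) • f := Module.End.mem_eigenspace_iff.1 hf
    rw [h]
    exact Submodule.smul_mem _ _ (mem_lowerSubmodule l.2 h)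
  · simp
  · intro f g hf hg
    rw [map_add]
    exact add_mem hf hg

/-- Eigenspaces for distinct eigenvalues are orthogonal, so the form is a sum of `l ‖g l‖ ^ 2` with
every `l ≤ c`. -/
theorem re_inner_le_of_mem_lowerSubmodule {A : H →L[ℂ] H} (hA : (A : H →ₗ[ℂ] H).IsSymmetric)
    {c : ℝ} {f : H} (hf : f ∈ lowerSubmodule A c) : (⟪A f, f⟫_ℂ).re ≤ c * ‖f‖ ^ 2 := by
  obtain ⟨g, hg, rfl⟩ := (Submodule.mem_iSup_iff_exists_finsupp _ _).1 hf
  have hg' : ∀ l : Iic c, A (g l) = ((l : ℝ) : ℂ) • g l := fun l =>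
    Module.End.mem_eigenspace_iff.1 (hg l)
  have hfam : OrthogonalFamily ℂ (fun l : Iic c => eigenspace A l)
      fun l => (eigenspace A l).subtypeₗᵢ :=
    hA.orthogonalFamily_eigenspaces.comp (γ := Iic c) (f := fun l => ((l : ℝ) : ℂ))
      fun a b hab => Subtype.ext (by simpa using hab)
  have hn : ‖∑ l ∈ g.support, g l‖ ^ 2 = ∑ l ∈ g.support, ‖g l‖ ^ 2 :=
    hfam.norm_sum (fun l => ⟨g l, hg l⟩) g.support
  have hi : ⟪∑ l ∈ g.support, ((l : ℝ) : ℂ) • g l, ∑ l ∈ g.support, g l⟫_ℂ =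
      ∑ l ∈ g.support, ⟪((l : ℝ) : ℂ) • g l, g l⟫_ℂ :=
    hfam.inner_sum (fun l => ((l : ℝ) : ℂ) • ⟨g l, hg l⟩) (fun l => ⟨g l, hg l⟩) g.support
  simp only [inner_smul_left, inner_self_eq_norm_sq_to_K] at hi
  rw [Finsupp.sum, map_sum, hn, Finset.sum_congr rfl fun l _ => hg' l, hi, Complex.re_sum,
    Finset.mul_sum]
  refine Finset.sum_le_sum fun l _ => ?_
  have : ((starRingEnd ℂ) ((l : ℝ) : ℂ) * ((‖g l‖ : ℝ) : ℂ) ^ 2).re = (l : ℝ) * ‖g l‖ ^ 2 := by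
    rw [Complex.conj_ofReal, ← Complex.ofReal_pow, ← Complex.ofReal_mul, Complex.ofReal_re]
  exact this.trans_le (mul_le_mul_of_nonneg_right l.2 (by positivity))

/-- Cauchy–Schwarz for a symmetric operator which is nonnegative on an invariant subspace. -/
theorem norm_sq_le_of_nonneg_on {P : H →L[ℂ] H} (hP : ∀ f g, ⟪P f, g⟫_ℂ = ⟪f, P g⟫_ℂ)
    {W : Submodule ℂ H} (hinv : ∀ f ∈ W, P f ∈ W) (hpos : ∀ f ∈ W, 0 ≤ (⟪P f, f⟫_ℂ).re)
    {M : ℝ} (hM : 0 < M) (hPM : ‖P‖ ≤ M) {f : H} (hf : f ∈ W) :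
    ‖P f‖ ^ 2 ≤ M * (⟪P f, f⟫_ℂ).re := by
  -- Positivity at `f - M⁻¹ P f` expands to `⟪P f, f⟫ - 2 M⁻¹ ‖P f‖ ^ 2 + M⁻² ⟪P (P f), P f⟫`, whose
  -- last term is at most `M⁻¹ ‖P f‖ ^ 2`.
  have h1 := hpos (f - ((M⁻¹ : ℝ) : ℂ) • P f)
    (W.sub_mem hf (W.smul_mem _ (hinv f hf)))
  have h2 : (⟪P (P f), P f⟫_ℂ).re ≤ M * ‖P f‖ ^ 2 := by
    have h3 : (⟪P (P f), P f⟫_ℂ).re ≤ ‖P (P f)‖ * ‖P f‖ := re_inner_le_norm (𝕜 := ℂ) _ _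
    have h4 := P.le_opNorm (P f)
    have h5 : ‖P‖ * ‖P f‖ ≤ M * ‖P f‖ := by gcongr
    nlinarith [norm_nonneg (P f)]
  have h6 : (⟪P f, P f⟫_ℂ).re = ‖P f‖ ^ 2 := re_inner_self _
  have h7 : ⟪P (P f), f⟫_ℂ = ⟪P f, P f⟫_ℂ := hP _ _
  rw [map_sub, map_smul, inner_sub_left, inner_sub_right, inner_sub_right, inner_smul_left,
    inner_smul_left, inner_smul_right, inner_smul_right, h7, Complex.conj_ofReal, Complex.sub_re,
    Complex.sub_re, Complex.sub_re, Complex.re_ofReal_mul, Complex.re_ofReal_mul,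
    Complex.re_ofReal_mul, h6] at h1
  have h8 : M⁻¹ * (M⁻¹ * (⟪P (P f), P f⟫_ℂ).re) ≤ M⁻¹ * ‖P f‖ ^ 2 := by
    refine mul_le_mul_of_nonneg_left ?_ (by positivity)
    rwa [inv_mul_le_iff₀ hM]
  have h9 : M⁻¹ * ‖P f‖ ^ 2 ≤ (⟪P f, f⟫_ℂ).re := by linarith
  rwa [inv_mul_le_iff₀ hM] at h9

variable [CompleteSpace H]

/-- If the quadratic form of `A = U - K`, with `U ≥ 0` and `K` compact, takes values below
`c ‖f‖²`, `c < 0`, on a closed invariant subspace, then the subspace contains an eigenvector with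
eigenvalue less than `c`. -/
theorem exists_eigenvector_lt {A U K : H →L[ℂ] H} (hA : (A : H →ₗ[ℂ] H).IsSymmetric)
    (hAUK : A = U - K) (hU : ∀ f, 0 ≤ (⟪U f, f⟫_ℂ).re) (hK : IsCompactOperator K)
    {W : Submodule ℂ H} (hW : IsClosed (W : Set H)) (hinv : ∀ f ∈ W, A f ∈ W) {c : ℝ} (hc : c < 0)
    (hlt : ∃ f ∈ W, (⟪A f, f⟫_ℂ).re < c * ‖f‖ ^ 2) :
    ∃ l < c, ∃ f ∈ W, f ≠ 0 ∧ A f = (l : ℂ) • f := by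
  -- The eigenvalue will be the infimum of the form over the unit sphere of `W`; the rest shows that
  -- it is attained.
  set S : Set ℝ := {r | ∃ f ∈ W, ‖f‖ = 1 ∧ (⟪A f, f⟫_ℂ).re = r} with hS
  have hbdd : BddBelow S := by
    refine ⟨-‖A‖, ?_⟩
    rintro _ ⟨f, -, hf, rfl⟩
    have h1 : |(⟪A f, f⟫_ℂ).re| ≤ ‖⟪A f, f⟫_ℂ‖ := Complex.abs_re_le_norm _
    have h2 := norm_inner_le_norm (𝕜 := ℂ) (A f) f
    have h3 := A.le_opNorm f
    rw [hf] at h2 h3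
    linarith [neg_abs_le (⟪A f, f⟫_ℂ).re]
  have hscale : ∀ f ∈ W, f ≠ 0 → (⟪A f, f⟫_ℂ).re / ‖f‖ ^ 2 ∈ S := by
    intro f hf hf0
    have hn : ‖f‖ ≠ 0 := norm_ne_zero_iff.2 hf0
    refine ⟨((‖f‖⁻¹ : ℝ) : ℂ) • f, W.smul_mem _ hf, ?_, ?_⟩
    · rw [norm_smul, Complex.norm_real, norm_inv, norm_norm, inv_mul_cancel₀ hn]
    · rw [map_smul, inner_smul_left, inner_smul_right, Complex.conj_ofReal,
        Complex.re_ofReal_mul, Complex.re_ofReal_mul]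
      field_simp
  obtain ⟨f₀, hf₀W, hf₀⟩ := hlt
  have hf₀0 : f₀ ≠ 0 := by rintro rfl; simp at hf₀
  have hne : S.Nonempty := ⟨_, hscale f₀ hf₀W hf₀0⟩
  set m := sInf S with hm
  have hmc : m < c := by
    refine (csInf_le hbdd (hscale f₀ hf₀W hf₀0)).trans_lt ?_
    rw [div_lt_iff₀ (by positivity)]
    exact hf₀
  have hm0 : m < 0 := hmc.trans hc
  set P : H →L[ℂ] H := A - (m : ℂ) • 1 with hP
  have hPapp : ∀ f, P f = A f - (m : ℂ) • f := fun f => by simp [hP]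
  have hPpos : ∀ f ∈ W, 0 ≤ (⟪P f, f⟫_ℂ).re := by
    intro f hf
    rw [hPapp, re_inner_sub_smul]
    rcases eq_or_ne f 0 with rfl | hf0
    · simp
    · have h1 := csInf_le hbdd (hscale f hf hf0)
      rw [← hm, le_div_iff₀ (by positivity)] at h1
      linarith
  have hseq : ∀ n : ℕ, ∃ f ∈ W, ‖f‖ = 1 ∧ (⟪A f, f⟫_ℂ).re < m + 1 / ((n : ℝ) + 1) := by
    intro n
    obtain ⟨_, ⟨f, hf, hf1, rfl⟩, h⟩ := exists_lt_of_csInf_lt hne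
      (show sInf S < m + 1 / ((n : ℝ) + 1) by rw [← hm]; linarith [Nat.one_div_pos_of_nat (α := ℝ) (n := n)])
    exact ⟨f, hf, hf1, h⟩
  choose f hfW hf1 hfm using hseq
  -- `A - m` is nonnegative on `W`, so a vanishing form along the minimizing sequence forces `P (f
  -- n) → 0` in norm.
  have hPf : Tendsto (fun n => P (f n)) atTop (𝓝 0) := by
    have hbound : ∀ n, ‖P (f n)‖ ^ 2 ≤ (‖P‖ + 1) * (1 / ((n : ℝ) + 1)) := by
      intro n
      refine (norm_sq_le_of_nonneg_on (fun a b => ?_) (fun a ha => ?_) hPpos (by positivity)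
        (by linarith : ‖P‖ ≤ ‖P‖ + 1) (hfW n)).trans ?_
      · rw [hPapp, hPapp]; exact isSymmetric_sub_smul hA m a b
      · rw [hPapp]; exact W.sub_mem (hinv a ha) (W.smul_mem _ ha)
      · refine mul_le_mul_of_nonneg_left ?_ (by positivity)
        rw [hPapp, re_inner_sub_smul, hf1]
        linarith [hfm n]
    have h1 : Tendsto (fun n : ℕ => (‖P‖ + 1) * (1 / ((n : ℝ) + 1))) atTop (𝓝 0) := by
      simpa using tendsto_one_div_add_atTop_nhds_zero_nat.const_mul (‖P‖ + 1)
    have h2 : Tendsto (fun n => ‖P (f n)‖ ^ 2) atTop (𝓝 0) :=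
      squeeze_zero (fun n => by positivity) hbound h1
    have h3 : Tendsto (fun n => ‖P (f n)‖) atTop (𝓝 0) := by
      have := h2.sqrt
      simpa [Real.sqrt_sq (norm_nonneg _)] using this
    exact tendsto_zero_iff_norm_tendsto_zero.2 h3
  -- Since `U - m = P + K`, convergence of `K (f n)` along a subsequence makes `(U - m) (f n)`
  -- converge; as `U - m ≥ -m > 0`, the vectors themselves then converge.
  obtain ⟨g, -, s, hs, hg⟩ := (hK.isCompact_closure_image_closedBall 1).tendsto_subseq
    (x := fun n => K (f n)) fun n => subset_closure
      (mem_image_of_mem _ (by simp [hf1 n]))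
  set R : H →L[ℂ] H := U - (m : ℂ) • 1 with hR
  have hRapp : ∀ f, R f = U f - (m : ℂ) • f := fun f => by simp [hR]
  have hRf : Tendsto (fun n => R (f (s n))) atTop (𝓝 g) := by
    have h1 : ∀ n, R (f (s n)) = P (f (s n)) + K (f (s n)) := fun n => by
      rw [hRapp, hPapp, hAUK, _root_.sub_apply]; abel
    simp_rw [h1]
    simpa using (hPf.comp hs.tendsto_atTop).add hg
  have hRb : ∀ h, (-m) * ‖h‖ ≤ ‖R h‖ := fun h => by
    refine le_norm_of_le_re_inner ?_
    rw [hRapp, re_inner_sub_smul]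
    linarith [hU h]
  obtain ⟨C, hC⟩ := antilipschitz_of_le_norm R (by linarith : 0 < -m) hRb
  have hcauchy : CauchySeq fun n => f (s n) := by
    have := hRf.cauchySeq
    exact (hC.isUniformInducing R.uniformContinuous).cauchy_map_iff.1 (by rwa [Filter.map_map])
  obtain ⟨φ, hφ⟩ := cauchySeq_tendsto_of_complete hcauchy
  have hφ1 : ‖φ‖ = 1 := tendsto_nhds_unique hφ.norm (by simp [hf1])
  refine ⟨m, hmc, φ, hW.mem_of_tendsto hφ (Eventually.of_forall fun n => hfW _), ?_, ?_⟩
  · rintro rfl; simp at hφ1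
  · have h1 : P φ = 0 := tendsto_nhds_unique ((P.continuous.tendsto φ).comp hφ)
      (hPf.comp hs.tendsto_atTop)
    rw [hPapp] at h1
    exact sub_eq_zero.1 h1

/-- On this span the form of `A` is at most `c`, so `U ≥ 0` forces the form of `K` to be at least
`-c > 0`; a compact operator allows this only in finite dimension. -/
theorem finiteDimensional_lowerSubmodule {A U K : H →L[ℂ] H} (hA : (A : H →ₗ[ℂ] H).IsSymmetric)
    (hAUK : A = U - K) (hU : ∀ f, 0 ≤ (⟪U f, f⟫_ℂ).re) (hK : IsCompactOperator K)
    {c : ℝ} (hc : c < 0) : FiniteDimensional ℂ (lowerSubmodule A c) := by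
  refine finiteDimensional_of_le_norm hK (by linarith : 0 < -c) fun f hf => ?_
  refine le_norm_of_le_re_inner ?_
  have h1 := re_inner_le_of_mem_lowerSubmodule hA hf
  rw [hAUK, _root_.sub_apply, inner_sub_left, Complex.sub_re] at h1
  linarith [hU f]

/-- An orthonormal family of eigenvectors of `A` that exhausts the part of `A` below `c`. -/
structure LowerEigenfamily (A : H →L[ℂ] H) (c : ℝ) where
  n : ℕ
  vec : Fin n → H
  val : Fin n → ℝ
  orthonormal : Orthonormal ℂ vec
  apply_vec : ∀ i, A (vec i) = (val i : ℂ) • vec i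
  val_le : ∀ i, val i ≤ c
  le_re_inner : ∀ f, (∀ i, ⟪vec i, f⟫_ℂ = 0) → c * ‖f‖ ^ 2 ≤ (⟪A f, f⟫_ℂ).re
  exists_val_eq : ∀ l ≤ c, IsEigenvalue A l → ∃ i, val i = l

/-- Diagonalizing `A` on the finite-dimensional invariant space `lowerSubmodule A c` gives the
family. -/
theorem nonempty_lowerEigenfamily {A U K : H →L[ℂ] H} (hA : (A : H →ₗ[ℂ] H).IsSymmetric)
    (hAUK : A = U - K) (hU : ∀ f, 0 ≤ (⟪U f, f⟫_ℂ).re) (hK : IsCompactOperator K)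
    {c : ℝ} (hc : c < 0) : Nonempty (LowerEigenfamily A c) := by
  set V := lowerSubmodule A c with hV
  have : FiniteDimensional ℂ V := finiteDimensional_lowerSubmodule hA hAUK hU hK hc
  have hinv : ∀ v ∈ V, (A : H →ₗ[ℂ] H) v ∈ V := fun v hv => map_mem_lowerSubmodule hv
  have hsym := hA.restrict_invariant hinv
  set b := hsym.eigenvectorBasis rfl with hb
  set ev := hsym.eigenvalues rfl with hev
  have hon : Orthonormal ℂ fun i => (b i : H) := b.orthonormal.comp_linearIsometry V.subtypeₗᵢ
  have happ : ∀ i, A (b i : H) = (ev i : ℂ) • (b i : H) := fun i =>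
    congrArg Subtype.val (hsym.apply_eigenvectorBasis rfl i)
  refine ⟨⟨_, fun i => (b i : H), ev, hon, happ, fun i => ?_, fun f hf => ?_, fun l hl hl' => ?_⟩⟩
  · have h1 := re_inner_le_of_mem_lowerSubmodule hA (b i).2
    rw [happ, inner_smul_left, Complex.conj_ofReal, Complex.re_ofReal_mul,
      inner_self_eq_norm_sq_to_K, hon.1 i] at h1
    simpa using h1
  · have hmem : ∀ f, (∀ i, ⟪(b i : H), f⟫_ℂ = 0) → f ∈ Vᗮ := by
      intro f hf v hv
      have hsum := b.sum_repr ⟨v, hv⟩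
      have hv' : v = ∑ i, b.repr ⟨v, hv⟩ i • (b i : H) := by
        have := congrArg Subtype.val hsum
        simpa using this.symm
      rw [hv', sum_inner]
      exact Finset.sum_eq_zero fun i _ => by rw [inner_smul_left, hf, mul_zero]
    by_contra hlt
    push Not at hlt
    -- A form value below `c` on `Vᗮ` would produce an eigenvector in `Vᗮ` with eigenvalue below
    -- `c`; it would also lie in `V`, hence be zero.
    obtain ⟨l, hl, g, hg, hg0, hAg⟩ := exists_eigenvector_lt hA hAUK hU hK
      V.isClosed_orthogonal (fun f hf v hv => by
        have h1 : ⟪A v, f⟫_ℂ = ⟪v, A f⟫_ℂ := hA v f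
        rw [← h1]
        exact hf _ (hinv v hv)) hc ⟨f, hmem f hf, hlt⟩
    exact hg0 (inner_self_eq_zero.1 (hg g (mem_lowerSubmodule hl.le hAg)))
  · obtain ⟨f, hf0, hf⟩ := hl'
    have hfV : f ∈ V := mem_lowerSubmodule hl hf
    have : Module.End.HasEigenvalue ((A : H →ₗ[ℂ] H).restrict hinv) (l : ℂ) := by
      refine Module.End.hasEigenvalue_of_hasEigenvector (x := ⟨f, hfV⟩)
        ⟨Module.End.mem_eigenspace_iff.2 (Subtype.ext hf), fun h => hf0 (congrArg Subtype.val h)⟩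
    obtain ⟨i, hi⟩ := hsym.exists_eigenvalues_eq rfl this
    exact ⟨i, Complex.ofReal_injective hi⟩

end CompactPerturbation

/-! ### Hilbert tensor products and the block decomposition of `A ⊗ 1 + 1 ⊗ B`. -/

section HilbertTensor

variable {H₁ H₂ G : Type*} [NormedAddCommGroup H₁] [InnerProductSpace ℂ H₁]
  [NormedAddCommGroup H₂] [InnerProductSpace ℂ H₂] [NormedAddCommGroup G] [InnerProductSpace ℂ G]

/-- The bilinear map `τ` exhibits `G` as the Hilbert tensor product of `H₁` and `H₂`. -/
structure IsHilbertTensor (τ : H₁ →ₗ[ℂ] H₂ →ₗ[ℂ] G) : Prop where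
  inner_apply : ∀ a b c d, ⟪τ a b, τ c d⟫_ℂ = ⟪a, c⟫_ℂ * ⟪b, d⟫_ℂ
  eq_zero : ∀ f, (∀ a b, ⟪τ a b, f⟫_ℂ = 0) → f = 0

variable {τ : H₁ →ₗ[ℂ] H₂ →ₗ[ℂ] G}

theorem IsHilbertTensor.flip (hτ : IsHilbertTensor τ) : IsHilbertTensor τ.flip where
  inner_apply a b c d := by simp [hτ.inner_apply, mul_comm]
  eq_zero f h := hτ.eq_zero f fun a b => h b a

theorem IsHilbertTensor.norm_apply (hτ : IsHilbertTensor τ) (a : H₁) (b : H₂) :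
    ‖τ a b‖ = ‖a‖ * ‖b‖ := by
  have h := hτ.inner_apply a b a b
  simp only [inner_self_eq_norm_sq_to_K] at h
  have h2 : ‖τ a b‖ ^ 2 = (‖a‖ * ‖b‖) ^ 2 := by
    rw [mul_pow]; exact_mod_cast h
  exact (pow_left_inj₀ (norm_nonneg _) (by positivity) two_ne_zero).1 h2

theorem IsHilbertTensor.orthonormal (hτ : IsHilbertTensor τ) {ι κ : Type*} {φ : ι → H₁}
    {ψ : κ → H₂} (hφ : Orthonormal ℂ φ) (hψ : Orthonormal ℂ ψ) :
    Orthonormal ℂ fun p : ι × κ => τ (φ p.1) (ψ p.2) := by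
  classical
  rw [orthonormal_iff_ite] at hφ hψ ⊢
  rintro ⟨i, j⟩ ⟨i', j'⟩
  rw [hτ.inner_apply, hφ, hψ]
  by_cases h1 : i = i' <;> by_cases h2 : j = j' <;> simp [h1, h2]

/-- The slice is the partial inner product of `f` with `b`, obtained as the adjoint of `a ↦ τ a b`.
-/
theorem IsHilbertTensor.exists_slice [CompleteSpace H₁] [CompleteSpace G] (hτ : IsHilbertTensor τ)
    (b : H₂) (f : G) : ∃ g : H₁, ∀ a, ⟪a, g⟫_ℂ = ⟪τ a b, f⟫_ℂ := by
  set J : H₁ →L[ℂ] G := (τ.flip b).mkContinuous ‖b‖ fun a => by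
    rw [LinearMap.flip_apply, hτ.norm_apply, mul_comm]
  exact ⟨ContinuousLinearMap.adjoint J f, fun a => ContinuousLinearMap.adjoint_inner_right J a f⟩

variable {ι κ : Type*} [Fintype ι] [Fintype κ]

theorem IsHilbertTensor.norm_sq_sum (hτ : IsHilbertTensor τ) {ψ : κ → H₂} (hψ : Orthonormal ℂ ψ)
    (g : κ → H₁) : ‖∑ j, τ (g j) (ψ j)‖ ^ 2 = ∑ j, ‖g j‖ ^ 2 := by
  classical
  have h2 : ((‖∑ j, τ (g j) (ψ j)‖ ^ 2 : ℝ) : ℂ) = ((∑ j, ‖g j‖ ^ 2 : ℝ) : ℂ) := by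
    rw [Complex.ofReal_pow, ← Complex.coe_algebraMap, ← inner_self_eq_norm_sq_to_K (𝕜 := ℂ),
      sum_inner]
    push_cast
    refine Finset.sum_congr rfl fun i _ => ?_
    rw [inner_sum]
    simp_rw [hτ.inner_apply, orthonormal_iff_ite.1 hψ]
    simp [inner_self_eq_norm_sq_to_K]
  exact_mod_cast h2

theorem IsHilbertTensor.inner_sum_sum_eq_zero (hτ : IsHilbertTensor τ) {ψ : κ → H₂}
    {φ : ι → H₁} {g : κ → H₁} {r : ι → H₂} (h : ∀ j i, ⟪g j, φ i⟫_ℂ = 0) :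
    ⟪∑ j, τ (g j) (ψ j), ∑ i, τ (φ i) (r i)⟫_ℂ = 0 := by
  rw [sum_inner]
  refine Finset.sum_eq_zero fun j _ => ?_
  rw [inner_sum]
  exact Finset.sum_eq_zero fun i _ => by rw [hτ.inner_apply, h, zero_mul]

variable [CompleteSpace G]

theorem IsHilbertTensor.clm_eq_zero (hτ : IsHilbertTensor τ) {R : G →L[ℂ] G}
    (h : ∀ a b, R (τ a b) = 0) : R = 0 := by
  have h1 : ContinuousLinearMap.adjoint R = 0 := by
    ext f
    refine hτ.eq_zero _ fun a b => ?_
    rw [ContinuousLinearMap.adjoint_inner_right, h, inner_zero_left]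
  rw [← ContinuousLinearMap.adjoint_adjoint R, h1, map_zero]

/-- Products are total, so an identity tested on them determines a bounded operator; here the
adjoint of `R` minus `R`. -/
theorem IsHilbertTensor.isSymmetric (hτ : IsHilbertTensor τ) {R : G →L[ℂ] G}
    (h : ∀ a b c d, ⟪R (τ a b), τ c d⟫_ℂ = ⟪τ a b, R (τ c d)⟫_ℂ) :
    (R : G →ₗ[ℂ] G).IsSymmetric := by
  have h1 : ContinuousLinearMap.adjoint R - R = 0 := by
    refine hτ.clm_eq_zero fun c d => hτ.eq_zero _ fun a b => ?_
    rw [_root_.sub_apply, inner_sub_right, ContinuousLinearMap.adjoint_inner_right, h, sub_self]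
  rw [← ContinuousLinearMap.isSelfAdjoint_iff_isSymmetric]
  exact sub_eq_zero.1 h1

theorem IsHilbertTensor.isSymmetric_of_apply (hτ : IsHilbertTensor τ) {A : H₁ →L[ℂ] H₁}
    (hA : (A : H₁ →ₗ[ℂ] H₁).IsSymmetric) {A' : G →L[ℂ] G}
    (h : ∀ a b, A' (τ a b) = τ (A a) b) : (A' : G →ₗ[ℂ] G).IsSymmetric :=
  hτ.isSymmetric fun a b c d => by
    rw [h, h, hτ.inner_apply, hτ.inner_apply]
    congr 1
    exact hA a c

variable [CompleteSpace H₁] [CompleteSpace H₂]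

/-- A lower bound for the form of `A` on the orthogonal complement of a family lifts to `A ⊗ 1`. -/
theorem IsHilbertTensor.le_re_inner {ι : Type*} (hτ : IsHilbertTensor τ) {A : H₁ →L[ℂ] H₁}
    (hA : (A : H₁ →ₗ[ℂ] H₁).IsSymmetric) {A' : G →L[ℂ] G} (hA' : ∀ a b, A' (τ a b) = τ (A a) b)
    {φ : ι → H₁} {c : ℝ} (hc : ∀ g, (∀ i, ⟪φ i, g⟫_ℂ = 0) → c * ‖g‖ ^ 2 ≤ (⟪A g, g⟫_ℂ).re)
    {f : G} (hf : ∀ i b, ⟪τ (φ i) b, f⟫_ℂ = 0) : c * ‖f‖ ^ 2 ≤ (⟪A' f, f⟫_ℂ).re := by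
  obtain ⟨w₁, d, -⟩ := exists_hilbertBasis ℂ H₁
  obtain ⟨w₂, e, -⟩ := exists_hilbertBasis ℂ H₂
  -- With the second factor as outer index, the expansion of the form groups into one sum per slice
  -- `g k`.
  have hon : Orthonormal ℂ fun p : w₂ × w₁ => τ (d p.2) (e p.1) :=
    (hτ.orthonormal d.orthonormal e.orthonormal).comp Prod.swap Prod.swap_injective
  have hbot : (Submodule.span ℂ (range fun p : w₂ × w₁ => τ (d p.2) (e p.1)))ᗮ = ⊥ := by
    rw [Submodule.eq_bot_iff]
    intro x hx
    refine hτ.eq_zero x fun a b => ?_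
    obtain ⟨g, hg⟩ := hτ.exists_slice b x
    rw [← hg]
    have hg0 : g = 0 := by
      have h1 : ∀ l, ⟪d l, g⟫_ℂ = 0 := by
        intro l
        obtain ⟨r, hr⟩ := hτ.flip.exists_slice (d l) x
        have hr0 : r = 0 := by
          have h2 : ∀ k, ⟪e k, r⟫_ℂ = 0 := fun k => by
            rw [hr]
            exact hx _ (Submodule.subset_span ⟨(k, l), rfl⟩)
          rw [← e.hasSum_repr r |>.tsum_eq]
          simp [e.repr_apply_apply, h2]
        rw [hg, ← LinearMap.flip_apply, ← hr, hr0, inner_zero_right]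
      rw [← d.hasSum_repr g |>.tsum_eq]
      simp [d.repr_apply_apply, h1]
    rw [hg0, inner_zero_right]
  set p := HilbertBasis.mkOfOrthogonalEqBot hon hbot with hp
  have hpapp : ∀ q, p q = τ (d q.2) (e q.1) := fun q => by
    rw [hp, HilbertBasis.coe_mkOfOrthogonalEqBot]
  choose g hg using fun k => hτ.exists_slice (e k) f
  -- Stated for an arbitrary pair of operators: the identity pair then gives `‖f‖ ^ 2 = ∑ ‖g k‖ ^
  -- 2`, and `hc` can be applied slice by slice.
  have key : ∀ {A : H₁ →L[ℂ] H₁} (_ : (A : H₁ →ₗ[ℂ] H₁).IsSymmetric) {A' : G →L[ℂ] G}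
      (_ : ∀ a b, A' (τ a b) = τ (A a) b),
      HasSum (fun k => (⟪A (g k), g k⟫_ℂ).re) (⟪A' f, f⟫_ℂ).re := by
    intro A hA A' hA'
    have h1 := p.hasSum_inner_mul_inner (A' f) f
    refine Complex.hasSum_re (h1.prod_fiberwise fun k => ?_)
    have h2 := d.hasSum_inner_mul_inner (A (g k)) (g k)
    convert h2 using 2 with l
    rw [hpapp, ← hg]
    congr 1
    have h3 : ⟪A' f, τ (d l) (e k)⟫_ℂ = ⟪f, A' (τ (d l) (e k))⟫_ℂ :=
      hτ.isSymmetric_of_apply hA hA' _ _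
    have h4 : ⟪A (g k), d l⟫_ℂ = ⟪g k, A (d l)⟫_ℂ := hA _ _
    rw [h3, h4, hA', ← inner_conj_symm, ← hg, inner_conj_symm]
  have hs1 := key hA hA'
  have hs2 := key (A := 1) (fun _ _ => rfl) (A' := 1) (fun _ _ => rfl)
  refine hasSum_le (fun k => ?_) (?_ : HasSum (fun k => c * ‖g k‖ ^ 2) (c * ‖f‖ ^ 2)) hs1
  · refine hc _ fun i => ?_
    rw [hg, hf]
  · simp only [one_apply_eq_self, re_inner_self] at hs2
    exact hs2.mul_left c

/-- The operator `A ⊗ 1 + 1 ⊗ B - E` is bounded below on the orthogonal complement of the products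
of eigenvectors, as soon as it is bounded below on each of the remaining blocks. -/
theorem IsHilbertTensor.le_norm_of_blocks (hτ : IsHilbertTensor τ)
    {A : H₁ →L[ℂ] H₁} (hA : (A : H₁ →ₗ[ℂ] H₁).IsSymmetric)
    {B : H₂ →L[ℂ] H₂} (hB : (B : H₂ →ₗ[ℂ] H₂).IsSymmetric)
    {A' B' : G →L[ℂ] G} (hA' : ∀ a b, A' (τ a b) = τ (A a) b) (hB' : ∀ a b, B' (τ a b) = τ a (B b))
    {φ : ι → H₁} (hφ : Orthonormal ℂ φ) {lam : ι → ℝ} (hlam : ∀ i, A (φ i) = (lam i : ℂ) • φ i)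
    {ψ : κ → H₂} (hψ : Orthonormal ℂ ψ) {mu : κ → ℝ} (hmu : ∀ j, B (ψ j) = (mu j : ℂ) • ψ j)
    {cA cB E ε : ℝ} (hε : 0 ≤ ε)
    (hcA : ∀ g, (∀ i, ⟪φ i, g⟫_ℂ = 0) → cA * ‖g‖ ^ 2 ≤ (⟪A g, g⟫_ℂ).re)
    (hcB : ∀ g, (∀ j, ⟪ψ j, g⟫_ℂ = 0) → cB * ‖g‖ ^ 2 ≤ (⟪B g, g⟫_ℂ).re)
    (hcE : ε ≤ cA + cB - E)
    (h1 : ∀ j g, (∀ i, ⟪φ i, g⟫_ℂ = 0) → ε * ‖g‖ ≤ ‖A g - ((E - mu j : ℝ) : ℂ) • g‖)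
    (h2 : ∀ i g, (∀ j, ⟪ψ j, g⟫_ℂ = 0) → ε * ‖g‖ ≤ ‖B g - ((E - lam i : ℝ) : ℂ) • g‖)
    {f : G} (hf : ∀ i j, ⟪τ (φ i) (ψ j), f⟫_ℂ = 0) :
    ε * ‖f‖ ≤ ‖(A' + B') f - (E : ℂ) • f‖ := by
  choose g hg using fun j => hτ.exists_slice (ψ j) f
  choose r hr using fun i => hτ.flip.exists_slice (φ i) f
  simp only [LinearMap.flip_apply] at hr
  have hgφ : ∀ j i, ⟪φ i, g j⟫_ℂ = 0 := fun j i => by rw [hg, hf]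
  have hrψ : ∀ i j, ⟪ψ j, r i⟫_ℂ = 0 := fun i j => by rw [hr, hf]
  -- As `f` has no component along the products `φ i ⊗ ψ j`, three orthogonal blocks remain: `{φ}ᗮ ⊗
  -- span ψ`, `span φ ⊗ {ψ}ᗮ` and `{φ}ᗮ ⊗ {ψ}ᗮ`.
  set f₁ := ∑ j, τ (g j) (ψ j) with hf₁
  set f₂ := ∑ i, τ (φ i) (r i) with hf₂
  set f₃ := f - (f₁ + f₂) with hf₃
  have hφ₃ : ∀ i b, ⟪τ (φ i) b, f₃⟫_ℂ = 0 := by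
    intro i b
    have e1 : ⟪τ (φ i) b, f₁⟫_ℂ = 0 := by
      rw [hf₁, inner_sum]
      exact Finset.sum_eq_zero fun j _ => by rw [hτ.inner_apply, hgφ, zero_mul]
    have e2 : ⟪τ (φ i) b, f₂⟫_ℂ = ⟪b, r i⟫_ℂ := by
      classical
      rw [hf₂, inner_sum]
      simp_rw [hτ.inner_apply, orthonormal_iff_ite.1 hφ]
      simp
    rw [hf₃, inner_sub_right, inner_add_right, e1, e2, hr, zero_add, sub_self]
  have hψ₃ : ∀ a j, ⟪τ a (ψ j), f₃⟫_ℂ = 0 := by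
    intro a j
    have e1 : ⟪τ a (ψ j), f₂⟫_ℂ = 0 := by
      rw [hf₂, inner_sum]
      exact Finset.sum_eq_zero fun i _ => by rw [hτ.inner_apply, hrψ, mul_zero]
    have e2 : ⟪τ a (ψ j), f₁⟫_ℂ = ⟪a, g j⟫_ℂ := by
      classical
      rw [hf₁, inner_sum]
      simp_rw [hτ.inner_apply, orthonormal_iff_ite.1 hψ]
      simp
    rw [hf₃, inner_sub_right, inner_add_right, e1, e2, hg, add_zero, sub_self]
  have hsym : ((A' + B' : G →L[ℂ] G) : G →ₗ[ℂ] G).IsSymmetric :=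
    (hτ.isSymmetric_of_apply hA hA').add (hτ.flip.isSymmetric_of_apply hB fun a b => hB' b a)
  set R : G → G := fun x => (A' + B') x - (E : ℂ) • x with hR
  set g' : κ → H₁ := fun j => A (g j) - ((E - mu j : ℝ) : ℂ) • g j with hg'
  set r' : ι → H₂ := fun i => B (r i) - ((E - lam i : ℝ) : ℂ) • r i with hr'
  have hRψ : ∀ a j, R (τ a (ψ j)) = τ (A a - ((E - mu j : ℝ) : ℂ) • a) (ψ j) := by
    intro a j
    simp only [hR, _root_.add_apply, hA', hB', hmu, map_sub, map_smul, LinearMap.sub_apply,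
      LinearMap.smul_apply]
    push_cast
    rw [sub_smul]; abel
  have hRφ : ∀ i b, R (τ (φ i) b) = τ (φ i) (B b - ((E - lam i : ℝ) : ℂ) • b) := by
    intro i b
    simp only [hR, _root_.add_apply, hA', hB', hlam, map_sub, map_smul, LinearMap.smul_apply]
    push_cast
    rw [sub_smul]; abel
  have hRadd : ∀ x y, R (x + y) = R x + R y := fun x y => by
    simp only [hR, map_add, smul_add]; abel
  have hRf₁ : R f₁ = ∑ j, τ (g' j) (ψ j) := by
    have : R f₁ = ∑ j, R (τ (g j) (ψ j)) := by
      simp only [hR, hf₁, map_sum, Finset.smul_sum, Finset.sum_sub_distrib]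
    rw [this]
    exact Finset.sum_congr rfl fun j _ => hRψ _ _
  have hRf₂ : R f₂ = ∑ i, τ (φ i) (r' i) := by
    have : R f₂ = ∑ i, R (τ (φ i) (r i)) := by
      simp only [hR, hf₂, map_sum, Finset.smul_sum, Finset.sum_sub_distrib]
    rw [this]
    exact Finset.sum_congr rfl fun i _ => hRφ _ _
  have hRsym : ∀ x y, ⟪R x, y⟫_ℂ = ⟪x, R y⟫_ℂ := isSymmetric_sub_smul hsym E
  have hg'φ : ∀ j i, ⟪g' j, φ i⟫_ℂ = 0 := by
    intro j i
    rw [hg', isSymmetric_sub_smul hA, hlam, ← sub_smul, inner_smul_right, ← inner_conj_symm, hgφ]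
    simp
  have hfsum : f = f₁ + f₂ + f₃ := by rw [hf₃]; abel
  have n1 : ‖f‖ ^ 2 = ∑ j, ‖g j‖ ^ 2 + ∑ i, ‖r i‖ ^ 2 + ‖f₃‖ ^ 2 := by
    conv_lhs => rw [hfsum]
    rw [norm_add_sq_of_inner_eq_zero, norm_add_sq_of_inner_eq_zero, hτ.norm_sq_sum hψ]
    · congr 2
      exact hτ.flip.norm_sq_sum hφ r
    · exact hτ.inner_sum_sum_eq_zero fun j i => by rw [← inner_conj_symm, hgφ, map_zero]
    · rw [inner_add_left, sum_inner, sum_inner, Finset.sum_eq_zero fun j _ => hψ₃ _ j,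
        Finset.sum_eq_zero fun i _ => hφ₃ i _, add_zero]
  -- The blocks are invariant under `R`; for the third one this follows from symmetry of `R` and its
  -- action on the other products.
  have n2 : ‖R f‖ ^ 2 = ∑ j, ‖g' j‖ ^ 2 + ∑ i, ‖r' i‖ ^ 2 + ‖R f₃‖ ^ 2 := by
    conv_lhs => rw [hfsum, hRadd, hRadd, hRf₁, hRf₂]
    rw [norm_add_sq_of_inner_eq_zero, norm_add_sq_of_inner_eq_zero, hτ.norm_sq_sum hψ]
    · congr 2
      exact hτ.flip.norm_sq_sum hφ r'
    · exact hτ.inner_sum_sum_eq_zero hg'φ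
    · rw [inner_add_left, sum_inner, sum_inner, Finset.sum_eq_zero fun j _ => ?_,
        Finset.sum_eq_zero fun i _ => ?_, add_zero]
      · rw [← hRsym, hRφ, hφ₃]
      · rw [← hRsym, hRψ, hψ₃]
  -- On the third block both form bounds lift, so the form of `R` is at least `cA + cB - E`.
  have n3 : ε * ‖f₃‖ ≤ ‖R f₃‖ := by
    refine le_norm_of_le_re_inner ?_
    rw [hR, re_inner_sub_smul, _root_.add_apply, inner_add_left, Complex.add_re]
    have e1 := hτ.le_re_inner hA hA' hcA hφ₃
    have e2 := hτ.flip.le_re_inner hB (fun a b => hB' b a) hcB (f := f₃) fun j a => hψ₃ a j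
    nlinarith [sq_nonneg ‖f₃‖]
  refine (abs_le_of_sq_le_sq' ?_ (norm_nonneg (R f))).2
  rw [mul_pow, n1, n2, mul_add, mul_add, Finset.mul_sum, Finset.mul_sum]
  refine add_le_add (add_le_add (Finset.sum_le_sum fun j _ => ?_)
    (Finset.sum_le_sum fun i _ => ?_)) ?_
  · rw [← mul_pow]
    exact pow_le_pow_left₀ (by positivity) (h1 j _ (hgφ j)) 2
  · rw [← mul_pow]
    exact pow_le_pow_left₀ (by positivity) (h2 i _ (hrψ i)) 2
  · rw [← mul_pow]
    exact pow_le_pow_left₀ (by positivity) n3 2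

end HilbertTensor

/-! ### Spectral gaps and the essential spectrum of the tensor sum. -/

section Gap

variable {H : Type*} [NormedAddCommGroup H] [InnerProductSpace ℂ H]

theorem LowerEigenfamily.isEigenvalue {A : H →L[ℂ] H} {c : ℝ} (F : LowerEigenfamily A c)
    (i : Fin F.n) : IsEigenvalue A (F.val i) :=
  ⟨F.vec i, F.orthonormal.ne_zero i, F.apply_vec i⟩

/-- There are no eigenvalues immediately to the right of a negative number. -/
theorem exists_gap {A : H →L[ℂ] H} {E : ℝ} (hE : E < 0) (F : LowerEigenfamily A (E / 2)) :
    ∃ δ > 0, δ ≤ -E / 2 ∧ ∀ l, IsEigenvalue A l → E < l → E + δ ≤ l := by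
  obtain ⟨c, hc, hcl⟩ := exists_pos_forall_le (fun i => if E < F.val i then F.val i - E else 1)
    fun i => by
      split_ifs with h
      · linarith
      · exact one_pos
  refine ⟨min c (-E / 2), lt_min hc (by linarith), min_le_right _ _, fun l hl hEl => ?_⟩
  rcases le_or_gt l (E / 2) with h | h
  · obtain ⟨i, rfl⟩ := F.exists_val_eq l h hl
    have := hcl i
    rw [if_pos hEl] at this
    linarith [min_le_left c (-E / 2)]
  · linarith [min_le_right c (-E / 2)]

/-- On the complement of the `φ i` the form of `A` lies between `-δ / 2` and `M`. In the first
alternative for `mu j`, `A - (E - mu j)` is at least `δ / 2`; in the second it is at most `mu j + M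
- E < 0`. -/
theorem exists_le_norm_sub_smul {A : H →L[ℂ] H} {ι κ : Type*} [Finite κ] {φ : ι → H} {mu : κ → ℝ}
    {E δ M : ℝ} (hδ : 0 < δ) (hM : ∀ f, (⟪A f, f⟫_ℂ).re ≤ M * ‖f‖ ^ 2)
    (hφ : ∀ g, (∀ i, ⟪φ i, g⟫_ℂ = 0) → (-δ / 2) * ‖g‖ ^ 2 ≤ (⟪A g, g⟫_ℂ).re)
    (hmu : ∀ j, E + δ ≤ mu j ∨ mu j + M < E) :
    ∃ ε > 0, ∀ j g, (∀ i, ⟪φ i, g⟫_ℂ = 0) → ε * ‖g‖ ≤ ‖A g - ((E - mu j : ℝ) : ℂ) • g‖ := by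
  obtain ⟨ε, hε, h⟩ := exists_pos_forall_le
    (fun j => if E + δ ≤ mu j then δ / 2 else E - mu j - M) fun j => by
      split_ifs with h
      · linarith
      · linarith [(hmu j).resolve_left h]
  refine ⟨ε, hε, fun j g hg => ?_⟩
  have hj := h j
  split_ifs at hj with hc
  · refine le_norm_of_le_re_inner ?_
    rw [re_inner_sub_smul]
    nlinarith [hφ g hg, sq_nonneg ‖g‖]
  · rw [← norm_neg (A g - _)]
    refine le_norm_of_le_re_inner ?_
    rw [inner_neg_left, Complex.neg_re, re_inner_sub_smul]
    nlinarith [hM g, sq_nonneg ‖g‖]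

end Gap

section TensorSpectrum

variable {H₁ H₂ G : Type*} [NormedAddCommGroup H₁] [InnerProductSpace ℂ H₁]
  [NormedAddCommGroup H₂] [InnerProductSpace ℂ H₂] [NormedAddCommGroup G] [InnerProductSpace ℂ G]
  {τ : H₁ →ₗ[ℂ] H₂ →ₗ[ℂ] G}

/-- The sum of an eigenvalue of `A` and a point of the spectrum of `B` belongs to the spectrum of
`A ⊗ 1 + 1 ⊗ B`. -/
theorem IsHilbertTensor.add_mem_spectrum [CompleteSpace H₂] (hτ : IsHilbertTensor τ)
    {A : H₁ →L[ℂ] H₁} {B : H₂ →L[ℂ] H₂} (hB : (B : H₂ →ₗ[ℂ] H₂).IsSymmetric)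
    {T : G →L[ℂ] G} (hT : ∀ a b, T (τ a b) = τ (A a) b + τ a (B b))
    {l m : ℝ} (hl : IsEigenvalue A l) (hm : m ∈ spectrum ℝ B) : l + m ∈ spectrum ℝ T := by
  by_contra hn
  obtain ⟨c, hc, h⟩ := exists_le_norm_of_notMem_spectrum hn
  obtain ⟨φ, hφ0, hφ⟩ := hl
  refine notMem_spectrum_of_le_norm hB hc (fun g => ?_) hm
  have h1 := h (τ φ g)
  have h2 : T (τ φ g) - ((l + m : ℝ) : ℂ) • τ φ g = τ φ (B g - (m : ℂ) • g) := by
    rw [hT, hφ]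
    simp only [map_smul, LinearMap.smul_apply, map_sub]
    push_cast
    rw [add_smul]; abel
  rw [h2, hτ.norm_apply, hτ.norm_apply] at h1
  have h3 : 0 < ‖φ‖ := norm_pos_iff.2 hφ0
  refine le_of_mul_le_mul_left ?_ h3
  linarith

variable [CompleteSpace H₁] [CompleteSpace H₂] [CompleteSpace G]

/-- The negative part of the essential spectrum of `A ⊗ 1 + 1 ⊗ B` is contained in the union of the
segments `[l, l + N]` and `[m, m + M]`, where `l` and `m` run over the negative eigenvalues of `A`
and `B`, and `M` and `N` are upper bounds for `A` and `B`. -/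
theorem IsHilbertTensor.notMem_essentialSpectrum (hτ : IsHilbertTensor τ)
    {A : H₁ →L[ℂ] H₁} (hA : (A : H₁ →ₗ[ℂ] H₁).IsSymmetric)
    {B : H₂ →L[ℂ] H₂} (hB : (B : H₂ →ₗ[ℂ] H₂).IsSymmetric)
    {A' B' : G →L[ℂ] G} (hA' : ∀ a b, A' (τ a b) = τ (A a) b) (hB' : ∀ a b, B' (τ a b) = τ a (B b))
    (FA : ∀ c < 0, Nonempty (LowerEigenfamily A c)) (FB : ∀ c < 0, Nonempty (LowerEigenfamily B c))
    {M N : ℝ} (hM : ∀ f, (⟪A f, f⟫_ℂ).re ≤ M * ‖f‖ ^ 2) (hN : ∀ f, (⟪B f, f⟫_ℂ).re ≤ N * ‖f‖ ^ 2)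
    {E : ℝ} (hE : E < 0) (hEA : ∀ l < 0, IsEigenvalue A l → E ∉ Icc l (l + N))
    (hEB : ∀ l < 0, IsEigenvalue B l → E ∉ Icc l (l + M)) :
    E ∉ essentialSpectrum (A' + B') := by
  obtain ⟨δA, hδA, hδAE, hgA⟩ := exists_gap hE (FA (E / 2) (by linarith)).some
  obtain ⟨δB, hδB, hδBE, hgB⟩ := exists_gap hE (FB (E / 2) (by linarith)).some
  set δ := min δA δB with hδ
  have hδ0 : 0 < δ := lt_min hδA hδB
  have hδA' : δ ≤ δA := min_le_left _ _
  have hδB' : δ ≤ δB := min_le_right _ _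
  -- The cutoff `-δ / 2` serves twice: it is half the gap to the right of `E`, and the two cutoffs
  -- together give at least `-δ - E ≥ -E / 2 > 0` on the block orthogonal to both families.
  obtain ⟨F₁⟩ := FA (-δ / 2) (by linarith)
  obtain ⟨F₂⟩ := FB (-δ / 2) (by linarith)
  have hmu : ∀ j, E + δ ≤ F₂.val j ∨ F₂.val j + M < E := fun j => by
    have h1 := hEB _ (by linarith [F₂.val_le j]) (F₂.isEigenvalue j)
    rcases lt_or_ge E (F₂.val j) with h | h
    · exact .inl (by linarith [hgB _ (F₂.isEigenvalue j) h])
    · exact .inr (by by_contra! h2; exact h1 ⟨h, h2⟩)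
  have hlam : ∀ j, E + δ ≤ F₁.val j ∨ F₁.val j + N < E := fun j => by
    have h1 := hEA _ (by linarith [F₁.val_le j]) (F₁.isEigenvalue j)
    rcases lt_or_ge E (F₁.val j) with h | h
    · exact .inl (by linarith [hgA _ (F₁.isEigenvalue j) h])
    · exact .inr (by by_contra! h2; exact h1 ⟨h, h2⟩)
  obtain ⟨ε₁, hε₁, h1⟩ := exists_le_norm_sub_smul hδ0 hM F₁.le_re_inner hmu
  obtain ⟨ε₂, hε₂, h2⟩ := exists_le_norm_sub_smul hδ0 hN F₂.le_re_inner hlam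
  set ε := min (min ε₁ ε₂) (-E / 2) with hε
  have hε0 : 0 < ε := lt_min (lt_min hε₁ hε₂) (by linarith)
  have hle1 : ε ≤ ε₁ := (min_le_left _ _).trans (min_le_left _ _)
  have hle2 : ε ≤ ε₂ := (min_le_left _ _).trans (min_le_right _ _)
  have hle3 : ε ≤ -E / 2 := min_le_right _ _
  have hsym : ((A' + B' : G →L[ℂ] G) : G →ₗ[ℂ] G).IsSymmetric :=
    (hτ.isSymmetric_of_apply hA hA').add (hτ.flip.isSymmetric_of_apply hB fun a b => hB' b a)
  refine notMem_essentialSpectrum_of_le_norm hsym (hτ.orthonormal F₁.orthonormal F₂.orthonormal)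
    (ν := fun p => F₁.val p.1 + F₂.val p.2) (fun p => ?_) hε0 fun f hf => ?_
  · rw [_root_.add_apply, hA', hB', F₁.apply_vec, F₂.apply_vec]
    simp [add_smul]
  · exact hτ.le_norm_of_blocks hA hB hA' hB' F₁.orthonormal F₁.apply_vec F₂.orthonormal
      F₂.apply_vec hε0.le F₁.le_re_inner F₂.le_re_inner (by linarith)
      (fun j g hg => (mul_le_mul_of_nonneg_right hle1 (norm_nonneg _)).trans (h1 j g hg))
      (fun i g hg => (mul_le_mul_of_nonneg_right hle2 (norm_nonneg _)).trans (h2 i g hg))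
      fun i j => hf (i, j)

end TensorSpectrum

/-! ### Multiplication operators. -/

section Multiplication

variable {Z : Type*} [MeasurableSpace Z] {μ : Measure Z} [TopologicalSpace Z] [CompactSpace Z]
  [OpensMeasurableSpace Z]

theorem mulOp_add (g h : C(Z, ℝ)) : mulOp μ (g + h) = mulOp μ g + mulOp μ h := by
  ext1 f
  refine Lp.ext ?_
  filter_upwards [mulOp_coe (μ := μ) (g + h) f, mulOp_coe (μ := μ) g f, mulOp_coe (μ := μ) h f,
    Lp.coeFn_add (mulOp μ g f) (mulOp μ h f)] with z h1 h2 h3 h4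
  rw [show (mulOp μ g + mulOp μ h) f = mulOp μ g f + mulOp μ h f from rfl, h1, h4, Pi.add_apply,
    h2, h3]
  simp [add_mul]

theorem mulOp_const_apply (c : ℝ) (f : Lp ℂ 2 μ) :
    mulOp μ (ContinuousMap.const Z c) f = (c : ℂ) • f := by
  refine Lp.ext ?_
  filter_upwards [mulOp_coe (μ := μ) (ContinuousMap.const Z c) f, Lp.coeFn_smul (c : ℂ) f]
    with z h1 h2
  rw [h1, h2]
  simp

theorem inner_mulOp (g : C(Z, ℝ)) (f h : Lp ℂ 2 μ) :
    ⟪mulOp μ g f, h⟫_ℂ = ∫ z, (g z : ℂ) * ⟪f z, h z⟫_ℂ ∂μ := by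
  rw [L2.inner_def]
  refine integral_congr_ae ?_
  filter_upwards [mulOp_coe (μ := μ) g f] with z h1
  rw [h1, RCLike.inner_apply, RCLike.inner_apply, map_mul, Complex.conj_ofReal]
  ring

theorem isSymmetric_mulOp (g : C(Z, ℝ)) :
    (mulOp μ g : Lp ℂ 2 μ →ₗ[ℂ] Lp ℂ 2 μ).IsSymmetric := by
  intro f h
  simp only [ContinuousLinearMap.coe_coe]
  rw [inner_mulOp, ← inner_conj_symm, inner_mulOp, ← integral_conj]
  refine integral_congr_ae (Eventually.of_forall fun z => ?_)
  simp only [map_mul, Complex.conj_ofReal, inner_conj_symm]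

theorem re_inner_mulOp_nonneg {g : C(Z, ℝ)} (hg : ∀ z, 0 ≤ g z) (f : Lp ℂ 2 μ) :
    0 ≤ (⟪mulOp μ g f, f⟫_ℂ).re := by
  have h : ∀ z, (g z : ℂ) * ⟪f z, f z⟫_ℂ = ((g z * ‖f z‖ ^ 2 : ℝ) : ℂ) := fun z => by
    rw [inner_self_eq_norm_sq_to_K]; push_cast; rfl
  rw [inner_mulOp]
  simp_rw [h]
  rw [integral_complex_ofReal, Complex.ofReal_re]
  exact integral_nonneg fun z => mul_nonneg (hg z) (by positivity)

theorem re_inner_mulOp_le {g : C(Z, ℝ)} {M : ℝ} (hg : ∀ z, g z ≤ M) (f : Lp ℂ 2 μ) :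
    (⟪mulOp μ g f, f⟫_ℂ).re ≤ M * ‖f‖ ^ 2 := by
  have h1 := re_inner_mulOp_nonneg (μ := μ) (g := ContinuousMap.const Z M - g)
    (fun z => by simpa using hg z) f
  have h2 := mulOp_add (μ := μ) (ContinuousMap.const Z M - g) g
  rw [sub_add_cancel] at h2
  have h3 := congrArg (fun X : Lp ℂ 2 μ →L[ℂ] Lp ℂ 2 μ => (⟪X f, f⟫_ℂ).re) h2
  simp only [mulOp_const_apply, _root_.add_apply, inner_add_left, inner_smul_left,
    Complex.conj_ofReal, Complex.re_ofReal_mul, Complex.add_re, re_inner_self] at h3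
  linarith

end Multiplication

/-! ### Compactness of integral operators with continuous kernel. -/

section IntegralOperator

theorem norm_opK_le (k : C(I × I, ℂ)) : ‖opK k‖ ≤ ‖k‖ := by
  unfold opK integralOp IsL2Bounded.toCLM
  exact LinearMap.mkContinuous_norm_le _ (norm_nonneg k) _

theorem integrable_kernel_mul (k : C(I × I, ℂ)) (f : L2) (x : I) :
    Integrable (fun s => k (x, s) * f s) := by
  have h1 : Integrable f := (Lp.memLp f).integrable (by norm_num)
  have h2 : Continuous fun s => k (x, s) := by fun_prop
  exact h1.bdd_mul (c := ‖k‖) h2.aestronglyMeasurable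
    (Eventually.of_forall fun s => k.norm_coe_le_norm _)

theorem opK_add (k k' : C(I × I, ℂ)) : opK (k + k') = opK k + opK k' := by
  ext1 f
  refine Lp.ext ?_
  filter_upwards [opK_coe (k + k') f, opK_coe k f, opK_coe k' f,
    Lp.coeFn_add (opK k f) (opK k' f)] with x h1 h2 h3 h4
  rw [h1, _root_.add_apply, h4, Pi.add_apply, h2, h3,
    ← integral_add (integrable_kernel_mul k f x) (integrable_kernel_mul k' f x)]
  simp [add_mul]

/-- `opK` as an additive map. -/
def opKHom : C(I × I, ℂ) →+ (L2 →L[ℂ] L2) := AddMonoidHom.mk' opK opK_add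

theorem isCompactOperator_opK_mul (p q : C(I, ℂ)) :
    IsCompactOperator (opK (p.comp ContinuousMap.fst * q.comp ContinuousMap.snd)) := by
  set P : L2 := ContinuousMap.toLp 2 volume ℂ p with hP
  set Q : L2 := ContinuousMap.toLp 2 volume ℂ (star q) with hQ
  have h : opK (p.comp ContinuousMap.fst * q.comp ContinuousMap.snd) =
      (ContinuousLinearMap.toSpanSingleton ℂ P).comp (innerSL ℂ Q) := by
    ext1 f
    have hin : ⟪Q, f⟫_ℂ = ∫ s, q s * f s := by
      rw [L2.inner_def]
      refine integral_congr_ae ?_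
      filter_upwards [ContinuousMap.coeFn_toLp (p := 2) (𝕜 := ℂ) volume (star q)] with s hs
      rw [RCLike.inner_apply, hQ, hs]
      simp [mul_comm]
    refine Lp.ext ?_
    filter_upwards [opK_coe (p.comp ContinuousMap.fst * q.comp ContinuousMap.snd) f,
      ContinuousMap.coeFn_toLp (p := 2) (𝕜 := ℂ) volume p, Lp.coeFn_smul (⟪Q, f⟫_ℂ) P]
      with x h1 h2 h3
    rw [h1]
    simp only [ContinuousLinearMap.comp_apply, innerSL_apply_apply,
      ContinuousLinearMap.toSpanSingleton_apply]
    rw [h3, Pi.smul_apply, hP, h2, hin, smul_eq_mul, ← integral_mul_const]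
    congr 1; ext s
    change p x * q s * f s = q s * f s * p x
    ring
  rw [h]
  exact (isCompactOperator_of_locallyCompactSpace_dom (innerSL ℂ Q)).clm_comp
    (ContinuousLinearMap.toSpanSingleton ℂ P)

/-- Bernstein approximation in `s`, applied to the `C(I)`-valued function `s ↦ k (·, s)`, gives
finite sums of product kernels converging uniformly to `k`. Their operators have finite rank and
converge in norm. -/
theorem isCompactOperator_opK (k : C(I × I, ℂ)) : IsCompactOperator (opK k) := by
  set F : C(I, C(I, ℂ)) := (k.comp ⟨Prod.swap, continuous_swap⟩).curry with hF
  have hFapp : ∀ s x, F s x = k (x, s) := fun s x => rfl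
  set b : ∀ n : ℕ, Fin (n + 1) → C(I, ℂ) := fun n j =>
    ⟨fun s => ((bernstein n j s : ℝ) : ℂ), by fun_prop⟩ with hb
  set kn : ℕ → C(I × I, ℂ) := fun n =>
    ∑ j : Fin (n + 1), (F (bernstein.z j)).comp ContinuousMap.fst *
      (b n j).comp ContinuousMap.snd with hkn
  have hknapp : ∀ n x s, kn n (x, s) = bernsteinApproximation n F s x := by
    intro n x s
    rw [bernsteinApproximation.apply, hkn]
    simp only [ContinuousMap.coe_sum, Finset.sum_apply, ContinuousMap.mul_apply,
      ContinuousMap.coe_smul, Pi.smul_apply, Complex.real_smul]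
    exact Finset.sum_congr rfl fun j _ => mul_comm _ _
  have hcomp : ∀ n, IsCompactOperator (opK (kn n)) := by
    intro n
    have h1 : opK (kn n) = ∑ j : Fin (n + 1), opK ((F (bernstein.z j)).comp ContinuousMap.fst *
        (b n j).comp ContinuousMap.snd) := map_sum opKHom _ _
    rw [h1]
    exact Submodule.sum_mem (compactOperator (RingHom.id ℂ) L2 L2)
      (t := Finset.univ) fun j _ => isCompactOperator_opK_mul _ _
  have hlim : Tendsto (fun n => opK (kn n)) atTop (𝓝 (opK k)) := by
    rw [tendsto_iff_norm_sub_tendsto_zero]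
    have h0 := tendsto_iff_norm_sub_tendsto_zero (E := C(I, C(I, ℂ))).1 (bernsteinApproximation_uniform F)
    refine squeeze_zero (fun n => norm_nonneg _) (fun n => ?_) h0
    have h1 : opK (kn n) - opK k = opK (kn n - k) := (map_sub opKHom _ _).symm
    rw [h1]
    refine (norm_opK_le _).trans ((ContinuousMap.norm_le _ (by positivity)).2 ?_)
    rintro ⟨x, s⟩
    have h2 := (bernsteinApproximation n F - F).norm_coe_le_norm s
    refine le_trans ?_ h2
    have h3 := ((bernsteinApproximation n F - F) s).norm_coe_le_norm x
    simpa [hknapp, hFapp] using h3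
  exact isCompactOperator_of_tendsto hlim (Eventually.of_forall hcomp)

end IntegralOperator

/-! ### Values of the potential lie in the spectrum. -/

section Spectrum

theorem volume_pos_of_isOpen {U : Set I} (hU : IsOpen U) {y : I} (hy : y ∈ U) : 0 < volume U := by
  obtain ⟨V, hV, rfl⟩ := isOpen_induced_iff.1 hU
  have hcl : (y : ℝ) ∈ closure (Ioo (0 : ℝ) 1) := by
    rw [closure_Ioo zero_ne_one]; exact y.2
  have hne : (V ∩ Ioo 0 1).Nonempty := mem_closure_iff.1 hcl V hV hy
  have h1 := (hV.inter isOpen_Ioo).measure_pos volume hne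
  rw [unitInterval.volume_apply]
  refine h1.trans_le (measure_mono ?_)
  rintro x ⟨hxV, hx⟩
  exact ⟨⟨x, Ioo_subset_Icc_self hx⟩, hxV, rfl⟩

/-- The bound is linear in the measure of `S`, whereas the indicator has norm equal to its square
root; so `K` is negligible on indicators of small sets. -/
theorem norm_opK_indicator_le (k : C(I × I, ℂ)) {S : Set I} (hS : MeasurableSet S) :
    ‖opK k (indicatorConstLp 2 hS (measure_ne_top _ S) 1)‖ ≤ ‖k‖ * volume.real S := by
  have h := Lp.norm_le_of_ae_bound (f := opK k (indicatorConstLp 2 hS (measure_ne_top _ S) 1))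
    (C := ‖k‖ * volume.real S) (by positivity) ?_
  · simpa [measureUnivNNReal] using h
  · filter_upwards [opK_coe k (indicatorConstLp 2 hS (measure_ne_top _ S) 1)] with x hx
    rw [hx]
    have h1 : ∫ s, k (x, s) * (indicatorConstLp 2 hS (measure_ne_top _ S) (1 : ℂ) : L2) s =
        ∫ s in S, k (x, s) := by
      rw [← integral_indicator hS]
      refine integral_congr_ae ?_
      filter_upwards [indicatorConstLp_coeFn (p := 2) (hs := hS)
        (hμs := measure_ne_top (volume : Measure I) S) (c := (1 : ℂ))] with s hs
      rw [hs]
      by_cases hsS : s ∈ S <;> simp [hsS]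
    rw [h1]
    exact norm_setIntegral_le_of_norm_le_const (measure_lt_top _ _)
      fun s _ => k.norm_coe_le_norm _

variable {v : C(I, ℝ)} {k : C(I × I, ℂ)}

theorem isSymmetric_opH (hk : (opK k).IsPositive) :
    (opH v k : L2 →ₗ[ℂ] L2).IsSymmetric :=
  (isSymmetric_mulOp v).sub hk.isSymmetric

/-- The values of `v` belong to the spectrum of `v - K`. -/
theorem mem_spectrum_opH (y : I) : v y ∈ spectrum ℝ (opH v k) := by
  by_contra hn
  obtain ⟨c, hc, hb⟩ := exists_le_norm_of_notMem_spectrum hn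
  -- If the measure of `S` is below `η`, its square root `r` satisfies `‖k‖ * r < c / 2`. The
  -- indicator of `S` then contradicts the lower bound `c`, the other `c / 2` being the oscillation
  -- of `v` on `S`.
  set η : ℝ := (c / (2 * (‖k‖ + 1))) ^ 2 with hη
  have hη0 : 0 < η := by positivity
  obtain ⟨U, hyU, hUo, hUη⟩ := Set.exists_isOpen_lt_of_lt ({y} : Set I) (ENNReal.ofReal η)
    (μ := volume) (by rw [measure_singleton]; exact ENNReal.ofReal_pos.2 hη0)
  set O : Set I := {x | |v x - v y| < c / 2} with hO
  have hOo : IsOpen O := isOpen_lt (by fun_prop) continuous_const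
  set S : Set I := U ∩ O with hSdef
  have hSo : IsOpen S := hUo.inter hOo
  have hyS : y ∈ S := ⟨hyU rfl, by simp [hO, hc]⟩
  have hS : MeasurableSet S := hSo.measurableSet
  have hspos : 0 < volume.real S :=
    ENNReal.toReal_pos (volume_pos_of_isOpen hSo hyS).ne' (measure_ne_top _ _)
  have hsη : volume.real S < η := by
    have h1 : volume S < ENNReal.ofReal η := (measure_mono inter_subset_left).trans_lt hUη
    exact (ENNReal.lt_ofReal_iff_toReal_lt (measure_ne_top _ _)).1 h1
  set g : L2 := indicatorConstLp 2 hS (measure_ne_top _ S) 1 with hg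
  have hgn : ‖g‖ = √(volume.real S) := by
    rw [hg, norm_indicatorConstLp (by norm_num) (by norm_num), norm_one, one_mul,
      Real.sqrt_eq_rpow]
    norm_num
  set r := √(volume.real S) with hr
  have hr0 : 0 < r := Real.sqrt_pos.2 hspos
  have hrr : volume.real S = r * r := (Real.mul_self_sqrt hspos.le).symm
  have h1 : ‖mulOp volume v g - ((v y : ℝ) : ℂ) • g‖ ≤ c / 2 * ‖g‖ := by
    refine Lp.norm_le_mul_norm_of_ae_le_mul ?_
    filter_upwards [Lp.coeFn_sub (mulOp volume v g) (((v y : ℝ) : ℂ) • g), mulOp_coe v g,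
      Lp.coeFn_smul ((v y : ℝ) : ℂ) g, indicatorConstLp_coeFn (p := 2) (hs := hS)
        (hμs := measure_ne_top (volume : Measure I) S) (c := (1 : ℂ))] with x e1 e2 e3 e4
    rw [e1, Pi.sub_apply, e2, e3, Pi.smul_apply, smul_eq_mul, ← sub_mul, norm_mul, hg, e4]
    by_cases hx : x ∈ S
    · have hxO : |v x - v y| < c / 2 := hx.2
      simp only [hx, indicator_of_mem, norm_one, mul_one]
      rw [← Complex.ofReal_sub, Complex.norm_real]
      exact hxO.le
    · simp [hx]
  have h2 := norm_opK_indicator_le k hS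
  rw [← hg] at h2
  have h3 := hb g
  have h4 : opH v k g - ((v y : ℝ) : ℂ) • g =
      (mulOp volume v g - ((v y : ℝ) : ℂ) • g) - opK k g := by
    rw [opH, _root_.sub_apply]; abel
  rw [h4] at h3
  have h5 := norm_sub_le (mulOp volume v g - ((v y : ℝ) : ℂ) • g) (opK k g)
  rw [hgn] at h1 h3
  have h6 : c / 2 * r ≤ ‖k‖ * r * r := by rw [hrr] at h2; linarith
  have h7 : c / 2 ≤ ‖k‖ * r := le_of_mul_le_mul_right h6 hr0
  have h8 : r < c / (2 * (‖k‖ + 1)) := by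
    refine lt_of_pow_lt_pow_left₀ 2 (by positivity) ?_
    rw [← hη, sq, ← hrr]; exact hsη
  rw [lt_div_iff₀ (by positivity)] at h8
  nlinarith [norm_nonneg k]

theorem nonempty_lowerEigenfamily_opH (hv : ∀ x, 0 ≤ v x) (hk : (opK k).IsPositive) {c : ℝ}
    (hc : c < 0) : Nonempty (LowerEigenfamily (opH v k) c) :=
  nonempty_lowerEigenfamily (isSymmetric_opH hk) rfl (re_inner_mulOp_nonneg hv)
    (isCompactOperator_opK k) hc

theorem re_inner_opH_le (hk : (opK k).IsPositive) {M : ℝ} (hM : ∀ x, v x ≤ M) (f : L2) :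
    (⟪opH v k f, f⟫_ℂ).re ≤ M * ‖f‖ ^ 2 := by
  have h1 : 0 ≤ (⟪opK k f, f⟫_ℂ).re := hk.re_inner_nonneg_left f
  rw [opH, _root_.sub_apply, inner_sub_left, Complex.sub_re]
  linarith [re_inner_mulOp_le (μ := volume) hM f]

end Spectrum

/-! ### The square `L²` space as a tensor product, and `T` as a tensor sum. -/

section Tensor

theorem memLp_tensor (a b : L2) :
    MemLp (fun z : I × I => a z.1 * b z.2) 2 (volume : Measure (I × I)) := by
  have ha := Lp.memLp a
  have hb := Lp.memLp b
  have hm : AEStronglyMeasurable (fun z : I × I => a z.1 * b z.2) (volume : Measure (I × I)) :=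
    (ha.1.comp_fst (ν := volume)).mul (hb.1.comp_snd (μ := volume))
  rw [memLp_two_iff_integrable_sq_norm hm]
  simp_rw [norm_mul, mul_pow]
  exact ((memLp_two_iff_integrable_sq_norm ha.1).1 ha).mul_prod
    ((memLp_two_iff_integrable_sq_norm hb.1).1 hb)

theorem ae_fst {p q : I → ℂ} (h : p =ᵐ[volume] q) :
    ∀ᵐ z : I × I, p z.1 = q z.1 :=
  Measure.quasiMeasurePreserving_fst.ae_eq_comp (μ := (volume : Measure (I × I))) h

theorem ae_snd {p q : I → ℂ} (h : p =ᵐ[volume] q) :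
    ∀ᵐ z : I × I, p z.2 = q z.2 :=
  Measure.quasiMeasurePreserving_snd.ae_eq_comp (μ := (volume : Measure (I × I))) h

/-- The product `(a ⊗ b)(x, y) = a(x) b(y)`. -/
def tensorFun (a b : L2) : L2sq := (memLp_tensor a b).toLp _

theorem tensorFun_coe (a b : L2) : tensorFun a b =ᵐ[volume] fun z => a z.1 * b z.2 :=
  (memLp_tensor a b).coeFn_toLp

/-- The product `(a ⊗ b)(x, y) = a(x) b(y)` as a bilinear map. -/
def tensor : L2 →ₗ[ℂ] L2 →ₗ[ℂ] L2sq :=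
  LinearMap.mk₂ ℂ tensorFun
    (fun a a' b => Lp.ext <| by
      filter_upwards [tensorFun_coe (a + a') b, tensorFun_coe a b, tensorFun_coe a' b,
        Lp.coeFn_add (tensorFun a b) (tensorFun a' b), ae_fst (Lp.coeFn_add a a')]
        with z h1 h2 h3 h4 h5
      rw [h1, h4, Pi.add_apply, h2, h3, h5, Pi.add_apply, add_mul])
    (fun c a b => Lp.ext <| by
      filter_upwards [tensorFun_coe (c • a) b, tensorFun_coe a b,
        Lp.coeFn_smul c (tensorFun a b), ae_fst (Lp.coeFn_smul c a)] with z h1 h2 h3 h4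
      rw [h1, h3, Pi.smul_apply, h2, h4, Pi.smul_apply, smul_mul_assoc])
    (fun a b b' => Lp.ext <| by
      filter_upwards [tensorFun_coe a (b + b'), tensorFun_coe a b, tensorFun_coe a b',
        Lp.coeFn_add (tensorFun a b) (tensorFun a b'), ae_snd (Lp.coeFn_add b b')]
        with z h1 h2 h3 h4 h5
      rw [h1, h4, Pi.add_apply, h2, h3, h5, Pi.add_apply, mul_add])
    (fun c a b => Lp.ext <| by
      filter_upwards [tensorFun_coe a (c • b), tensorFun_coe a b,
        Lp.coeFn_smul c (tensorFun a b), ae_snd (Lp.coeFn_smul c b)] with z h1 h2 h3 h4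
      rw [h1, h3, Pi.smul_apply, h2, h4, Pi.smul_apply, mul_smul_comm])

theorem tensor_coe (a b : L2) : tensor a b =ᵐ[volume] fun z => a z.1 * b z.2 :=
  tensorFun_coe a b

theorem inner_tensor (a b c d : L2) : ⟪tensor a b, tensor c d⟫_ℂ = ⟪a, c⟫_ℂ * ⟪b, d⟫_ℂ := by
  rw [L2.inner_def, L2.inner_def, L2.inner_def]
  refine (integral_congr_ae ?_).trans (integral_prod_mul _ _)
  filter_upwards [tensor_coe a b, tensor_coe c d] with z h1 h2
  simp only [h1, h2, RCLike.inner_apply, map_mul]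
  ring

/-- Testing against indicators gives zero integrals over rectangles; the π-λ theorem extends this to
all measurable sets. -/
theorem eq_zero_of_inner_tensor (f : L2sq) (h : ∀ a b, ⟪tensor a b, f⟫_ℂ = 0) : f = 0 := by
  have hint : Integrable f := (Lp.memLp f).integrable (by norm_num)
  rw [Lp.eq_zero_iff_ae_eq_zero]
  refine hint.ae_eq_zero_of_forall_setIntegral_eq_zero fun s hs _ => ?_
  have hrect : ∀ S R : Set I, MeasurableSet S → MeasurableSet R → ∫ z in S ×ˢ R, f z = 0 := by
    intro S R hS hR
    have h1 := h (indicatorConstLp 2 hS (measure_ne_top _ S) 1)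
      (indicatorConstLp 2 hR (measure_ne_top _ R) 1)
    rw [← h1, L2.inner_def, ← integral_indicator (hS.prod hR)]
    refine integral_congr_ae ?_
    filter_upwards [tensor_coe (indicatorConstLp 2 hS (measure_ne_top _ S) 1)
      (indicatorConstLp 2 hR (measure_ne_top _ R) 1),
      ae_fst (indicatorConstLp_coeFn (p := 2) (hs := hS)
        (hμs := measure_ne_top (volume : Measure I) S) (c := (1 : ℂ))),
      ae_snd (indicatorConstLp_coeFn (p := 2) (hs := hR)
        (hμs := measure_ne_top (volume : Measure I) R) (c := (1 : ℂ)))] with z e1 e2 e3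
    rw [e1, e2, e3, RCLike.inner_apply]
    by_cases hz1 : z.1 ∈ S <;> by_cases hz2 : z.2 ∈ R <;> simp [indicator, hz1, hz2]
  induction s, hs using MeasurableSpace.induction_on_inter generateFrom_prod.symm isPiSystem_prod
    with
  | empty => simp
  | basic t ht =>
    obtain ⟨S, hS, R, hR, rfl⟩ := ht
    exact hrect S R hS hR
  | compl t ht ih =>
    have huniv : ∫ z, f z = 0 := by
      have := hrect univ univ .univ .univ
      rwa [univ_prod_univ, setIntegral_univ] at this
    rw [setIntegral_compl ht hint, ih (measure_lt_top _ _), huniv, sub_zero]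
  | iUnion t hd ht ih =>
    rw [integral_iUnion ht hd hint.integrableOn]
    simp [fun i => ih i (measure_lt_top _ _)]

theorem isHilbertTensor_tensor : IsHilbertTensor tensor :=
  ⟨inner_tensor, eq_zero_of_inner_tensor⟩

theorem mulOp_fst_tensor (u : C(I, ℝ)) (a b : L2) :
    mulOp volume (u.comp ContinuousMap.fst) (tensor a b) = tensor (mulOp volume u a) b := by
  refine Lp.ext ?_
  filter_upwards [mulOp_coe (u.comp ContinuousMap.fst) (tensor a b), tensor_coe a b,
    tensor_coe (mulOp volume u a) b, ae_fst (mulOp_coe u a)] with z h1 h2 h3 h4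
  rw [h1, h2, h3, h4]
  simp [mul_assoc]

theorem mulOp_snd_tensor (v : C(I, ℝ)) (a b : L2) :
    mulOp volume (v.comp ContinuousMap.snd) (tensor a b) = tensor a (mulOp volume v b) := by
  refine Lp.ext ?_
  filter_upwards [mulOp_coe (v.comp ContinuousMap.snd) (tensor a b), tensor_coe a b,
    tensor_coe a (mulOp volume v b), ae_snd (mulOp_coe v b)] with z h1 h2 h3 h4
  rw [h1, h2, h3, h4]
  change (v z.2 : ℂ) * (a z.1 * b z.2) = a z.1 * ((v z.2 : ℂ) * b z.2)
  ring

theorem opT1_tensor (k : C(I × I, ℂ)) (a b : L2) :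
    opT1 k (tensor a b) = tensor (opK k a) b := by
  refine Lp.ext ?_
  have hc := (isL2Bounded_integral volume
    (k.comp ⟨fun p : (I × I) × I => (p.1.1, p.2), by fun_prop⟩) measurePreserving_fst_var).congr
    _ _ (tensor_coe a b)
  filter_upwards [opT1_coe k (tensor a b), hc, tensor_coe (opK k a) b, ae_fst (opK_coe k a)]
    with z h1 h2 h3 h4
  rw [h1, h3, h4, ← integral_mul_const]
  refine h2.trans ?_
  simp only [ContinuousMap.comp_apply, ContinuousMap.coe_mk, mul_assoc]

theorem opT2_tensor (k : C(I × I, ℂ)) (a b : L2) :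
    opT2 k (tensor a b) = tensor a (opK k b) := by
  refine Lp.ext ?_
  have hc := (isL2Bounded_integral volume
    (k.comp ⟨fun p : (I × I) × I => (p.1.2, p.2), by fun_prop⟩) measurePreserving_snd_var).congr
    _ _ (tensor_coe a b)
  filter_upwards [opT2_coe k (tensor a b), hc, tensor_coe a (opK k b), ae_snd (opK_coe k b)]
    with z h1 h2 h3 h4
  rw [h1, h3, h4, ← integral_const_mul]
  refine h2.trans ?_
  simp only [ContinuousMap.comp_apply, ContinuousMap.coe_mk]
  congr 1; ext s; ring

/-- The lift `H₁ ⊗ 1` of `H₁` to `L²([0,1]²)`. -/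
def leftOp (u : C(I, ℝ)) (k : C(I × I, ℂ)) : L2sq →L[ℂ] L2sq :=
  mulOp volume (u.comp ContinuousMap.fst) - opT1 k

/-- The lift `1 ⊗ H₂` of `H₂` to `L²([0,1]²)`. -/
def rightOp (v : C(I, ℝ)) (k : C(I × I, ℂ)) : L2sq →L[ℂ] L2sq :=
  mulOp volume (v.comp ContinuousMap.snd) - opT2 k

theorem leftOp_tensor (u : C(I, ℝ)) (k : C(I × I, ℂ)) (a b : L2) :
    leftOp u k (tensor a b) = tensor (opH u k a) b := by
  rw [leftOp, opH, _root_.sub_apply, _root_.sub_apply, mulOp_fst_tensor, opT1_tensor, map_sub,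
    LinearMap.sub_apply]

theorem rightOp_tensor (v : C(I, ℝ)) (k : C(I × I, ℂ)) (a b : L2) :
    rightOp v k (tensor a b) = tensor a (opH v k b) := by
  rw [rightOp, opH, _root_.sub_apply, _root_.sub_apply, mulOp_snd_tensor, opT2_tensor, map_sub]

theorem opT_eq (u v : C(I, ℝ)) (k₁ k₂ : C(I × I, ℂ)) :
    opT u v k₁ k₂ = leftOp u k₁ + rightOp v k₂ := by
  rw [opT, opT0, mulOp_add, leftOp, rightOp]
  abel

theorem opT_tensor (u v : C(I, ℝ)) (k₁ k₂ : C(I × I, ℂ)) (a b : L2) :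
    opT u v k₁ k₂ (tensor a b) = tensor (opH u k₁ a) b + tensor a (opH v k₂ b) := by
  rw [opT_eq, _root_.add_apply, leftOp_tensor, rightOp_tensor]

end Tensor

/-! ### Segments of spectrum and left endpoints. -/

section DiscreteSpectrum

variable {H : Type*} [NormedAddCommGroup H] [InnerProductSpace ℂ H]

theorem notMem_discreteSpectrum_of_Icc_subset {A : H →L[ℂ] H} {a b l : ℝ} (hab : a < b)
    (h : Icc a b ⊆ spectrum ℝ A) (hl : l ∈ Icc a b) : l ∉ discreteSpectrum A := by
  rintro ⟨-, -, δ, hδ, hiso⟩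
  have key : ∀ t ∈ Icc a b, t ∈ Ioo (l - δ) (l + δ) → t = l := fun t ht ht' => by
    have : t ∈ Ioo (l - δ) (l + δ) ∩ spectrum ℝ A := ⟨ht', h ht⟩
    rwa [hiso] at this
  rcases hl.2.lt_or_eq with hlb | rfl
  · have h1 : l < min (l + δ / 2) b := lt_min (by linarith) hlb
    have h2 : min (l + δ / 2) b ≤ l + δ / 2 := min_le_left _ _
    exact h1.ne' (key _ ⟨hl.1.trans h1.le, min_le_right _ _⟩ ⟨by linarith, by linarith⟩)
  · have h1 : max (l - δ / 2) a < l := max_lt (by linarith) hab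
    have h2 : l - δ / 2 ≤ max (l - δ / 2) a := le_max_left _ _
    exact h1.ne (key _ ⟨le_max_right _ _, h1.le⟩ ⟨by linarith, by linarith⟩)

/-- A nondegenerate segment of the spectrum cannot contain the left endpoint of a component of the
essential spectrum, except as its own left endpoint. -/
theorem lt_of_isLeftEndpoint {A : H →L[ℂ] H} {a b s : ℝ}
    (hs : IsLeftEndpoint (essentialSpectrum A) s) (h : Icc a b ⊆ spectrum ℝ A) (has : a < s) :
    b < s := by
  by_contra! hsb
  -- No point of a nondegenerate segment of the spectrum is isolated, so the segment from `a` to `s`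
  -- is essential and joins `a < s` to the component of `s`.
  have hsub : Icc a s ⊆ essentialSpectrum A := fun t ht =>
    have ht' : t ∈ Icc a b := ⟨ht.1, ht.2.trans hsb⟩
    ⟨h ht', notMem_discreteSpectrum_of_Icc_subset (has.trans_le hsb) h ht'⟩
  have := isPreconnected_Icc.subset_connectedComponentIn (right_mem_Icc.2 has.le) hsub
    (left_mem_Icc.2 has.le)
  exact absurd (hs.2 this) (not_le.2 has)

/-- In finite dimension the discrete spectrum is finite. -/
theorem finite_discreteSpectrum [FiniteDimensional ℂ H] (A : H →L[ℂ] H) :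
    (discreteSpectrum A).Finite := by
  have h := (Module.End.finite_hasEigenvalue (A : H →ₗ[ℂ] H)).preimage
    Complex.ofReal_injective.injOn
  refine h.subset ?_
  rintro l ⟨⟨f, hf0, hf⟩, -⟩
  exact Module.End.hasEigenvalue_of_hasEigenvector ⟨Module.End.mem_eigenspace_iff.2 hf, hf0⟩

end DiscreteSpectrum

/-! ### Location of the discrete spectrum of `v - K`. -/

section FriedrichsModel

variable {v : C(I, ℝ)} {k : C(I × I, ℂ)}

theorem Icc_subset_range (hv0 : ∃ x, v x = 0) (y : I) : Icc 0 (v y) ⊆ range v := by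
  obtain ⟨x, hx⟩ := hv0
  rw [← hx]
  exact intermediate_value_univ x y v.continuous

theorem exists_forall_le (v : C(I, ℝ)) : ∃ y, ∀ x, v x ≤ v y := by
  obtain ⟨y, -, hy⟩ := isCompact_univ.exists_isMaxOn univ_nonempty v.continuous.continuousOn
  exact ⟨y, fun x => hy (mem_univ x)⟩

/-- The discrete spectrum of `v - K` is negative unless `v = 0`. -/
theorem neg_or_eq_zero_of_mem_discreteSpectrum (hv : ∀ x, 0 ≤ v x) (hv0 : ∃ x, v x = 0)
    (hk : (opK k).IsPositive) {l : ℝ} (hl : l ∈ discreteSpectrum (opH v k)) :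
    l < 0 ∨ l = 0 ∧ ∀ x, v x = 0 := by
  obtain ⟨y, hy⟩ := exists_forall_le v
  have hle : l ≤ v y := by
    obtain ⟨f, hf0, hf⟩ := hl.1
    have h1 := re_inner_opH_le hk hy f
    rw [hf, inner_smul_left, Complex.conj_ofReal, Complex.re_ofReal_mul, re_inner_self] at h1
    have h2 : 0 < ‖f‖ := norm_pos_iff.2 hf0
    exact le_of_mul_le_mul_right h1 (by positivity)
  rcases lt_or_ge l 0 with h0 | h0
  · exact .inl h0
  rcases (hv y).lt_or_eq with hy0 | hy0
  -- If `max v > 0`, the interval `[0, max v]` is a nondegenerate segment of the spectrum.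
  · refine absurd hl (notMem_discreteSpectrum_of_Icc_subset hy0 (fun t ht => ?_) ⟨h0, hle⟩)
    obtain ⟨x, rfl⟩ := Icc_subset_range hv0 y ht
    exact mem_spectrum_opH x
  · exact .inr ⟨by linarith, fun x => le_antisymm ((hy x).trans hy0.ge) (hv x)⟩

/-- If `0` belonged to the discrete spectrum of `-K`, then `L²[0,1]` would be finite-dimensional. -/
theorem finiteDimensional_of_zero_mem_discreteSpectrum (hv : ∀ x, v x = 0)
    (hk : (opK k).IsPositive) (h0 : (0 : ℝ) ∈ discreteSpectrum (opH v k)) :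
    FiniteDimensional ℂ L2 := by
  obtain ⟨-, hfin, δ, hδ, hiso⟩ := h0
  have hv' : ∀ x, 0 ≤ v x := fun x => (hv x).ge
  have hsym := isSymmetric_opH (v := v) hk
  set B := opH v k with hB
  set V := lowerSubmodule B (-δ / 2) with hV
  have hVfin : FiniteDimensional ℂ V := finiteDimensional_lowerSubmodule hsym rfl
    (re_inner_mulOp_nonneg hv') (isCompactOperator_opK k) (by linarith)
  have hle : ∀ f, (⟪B f, f⟫_ℂ).re ≤ 0 := fun f => by
    simpa using re_inner_opH_le (M := 0) hk (fun x => (hv x).le) f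
  -- As `0` is isolated, all negative eigenvalues are at most `-δ`, so vectors in `Vᗮ` are
  -- orthogonal to every negative eigenvector. There the form is nonnegative; since `B = -K ≤ 0` it
  -- vanishes, and Cauchy–Schwarz gives `B f = 0`.
  have hker : Vᗮ ≤ eigenspace B 0 := by
    intro f hf
    have h1 : ∀ c < 0, c * ‖f‖ ^ 2 ≤ (⟪B f, f⟫_ℂ).re := by
      intro c hc
      obtain ⟨F⟩ := nonempty_lowerEigenfamily_opH (v := v) hv' hk hc
      refine F.le_re_inner f fun i => hf _ (mem_lowerSubmodule ?_ (F.apply_vec i))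
      by_contra! hlt
      have hneg := (F.val_le i).trans_lt hc
      exact hneg.ne (hiso.subset
        ⟨⟨by linarith, by linarith⟩, mem_spectrum_of_isEigenvalue (F.isEigenvalue i)⟩)
    have h2 : 0 ≤ (⟪B f, f⟫_ℂ).re := by
      refine le_of_forall_pos_le_add fun ε hε => ?_
      have h3 := h1 (-(ε / (‖f‖ ^ 2 + 1))) (by have : 0 < ε / (‖f‖ ^ 2 + 1) := by positivity
                                               linarith)
      have h4 : ε / (‖f‖ ^ 2 + 1) * ‖f‖ ^ 2 ≤ ε := by
        rw [div_mul_eq_mul_div, div_le_iff₀ (by positivity)]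
        nlinarith
      linarith
    have h3 : (⟪B f, f⟫_ℂ).re = 0 := le_antisymm (hle f) h2
    have h4 := norm_sq_le_of_nonneg_on (P := -B) (W := ⊤)
      (fun a b => by
        simp only [_root_.neg_apply, inner_neg_left, inner_neg_right]
        exact congrArg Neg.neg (hsym a b))
      (fun _ _ => trivial)
      (fun a _ => by
        simp only [_root_.neg_apply, inner_neg_left, Complex.neg_re]
        linarith [hle a])
      (by positivity : 0 < ‖-B‖ + 1) (by linarith) (f := f) trivial
    simp only [_root_.neg_apply, inner_neg_left, Complex.neg_re, h3, norm_neg, neg_zero,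
      mul_zero] at h4
    have h5 : B f = 0 := norm_eq_zero.1 (by nlinarith [norm_nonneg (B f)])
    exact Module.End.mem_eigenspace_iff.2 (by simpa using h5)
  have hperp : FiniteDimensional ℂ Vᗮ := Submodule.finiteDimensional_of_le hker
  have hsup : FiniteDimensional ℂ (V ⊔ Vᗮ : Submodule ℂ L2) := inferInstance
  rw [Submodule.sup_orthogonal_of_hasOrthogonalProjection] at hsup
  exact (Submodule.topEquiv (R := ℂ) (M := L2)).finiteDimensional

/-- If the discrete spectrum is infinite, the negative eigenvalues accumulate at zero. -/
theorem exists_isEigenvalue_near_zero (hv : ∀ x, 0 ≤ v x) (hv0 : ∃ x, v x = 0)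
    (hk : (opK k).IsPositive) (hinf : (discreteSpectrum (opH v k)).Infinite) {c : ℝ} (hc : c < 0) :
    ∃ l, IsEigenvalue (opH v k) l ∧ c < l ∧ l < 0 := by
  by_contra! hno
  obtain ⟨F⟩ := nonempty_lowerEigenfamily_opH (v := v) hv hk hc
  -- Without eigenvalues in `(c, 0)` the discrete spectrum would consist of the finitely many values
  -- up to `c` and possibly `0`, the latter occurring only for `v = 0`.
  refine hinf (((finite_range F.val).insert 0).subset fun l hl => ?_)
  rcases neg_or_eq_zero_of_mem_discreteSpectrum hv hv0 hk hl with h | h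
  · refine mem_insert_of_mem _ (F.exists_val_eq l ?_ hl.1)
    by_contra! hcl
    exact absurd (hno l hl.1 hcl) (not_le.2 h)
  · exact h.1 ▸ mem_insert _ _

end FriedrichsModel

/-- If the segments `[l, l + N]` starting at eigenvalues `l < β` do not reach `β`, they stay at
positive distance from it. -/
theorem exists_pos_notMem_Icc {H : Type*} [NormedAddCommGroup H] [InnerProductSpace ℂ H]
    {A : H →L[ℂ] H} {β N : ℝ} (F : LowerEigenfamily A β)
    (h : ∀ l < β, IsEigenvalue A l → l + N < β) :
    ∃ δ > 0, ∀ E ∈ Ioo (β - δ) β, ∀ l, IsEigenvalue A l → E ∉ Icc l (l + N) := by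
  obtain ⟨δ, hδ, hle⟩ := exists_pos_forall_le
    (fun i => if F.val i < β then β - (F.val i + N) else 1) fun i => by
      split_ifs with hi
      · linarith [h _ hi (F.isEigenvalue i)]
      · exact one_pos
  refine ⟨δ, hδ, fun E hE l hl hEl => ?_⟩
  have hlβ : l < β := hEl.1.trans_lt hE.2
  obtain ⟨i, rfl⟩ := F.exists_val_eq l hlβ.le hl
  have := hle i
  rw [if_pos hlβ] at this
  linarith [hE.1, hEl.2]

end Efimov

end

/-! ### The Efimov effect at `β`. -/

theorem mainTheorem8
    (u v : C(unitInterval, ℝ))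
    (hu : ∀ x, 0 ≤ u x) (hu0 : ∃ x, u x = 0)
    (hv : ∀ x, 0 ≤ v x) (hv0 : ∃ x, v x = 0)
    (k₁ k₂ : C(unitInterval × unitInterval, ℂ))
    (hk₁ : ∀ x s, k₁ (x, s) = star (k₁ (s, x)))
    (hk₂ : ∀ x s, k₂ (x, s) = star (k₂ (s, x)))
    (hK₁ : (Efimov.opK k₁).IsPositive) (hK₂ : (Efimov.opK k₂).IsPositive)
    (hH₁ : (Efimov.discreteSpectrum (Efimov.opH u k₁)).Infinite)
    (hH₂ : (Efimov.discreteSpectrum (Efimov.opH v k₂)).Finite)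
    (hH₂' : (Efimov.discreteSpectrum (Efimov.opH v k₂)).Nonempty)
    (β : ℝ) (hβ : β ∈ Efimov.discreteSpectrum (Efimov.opH v k₂))
    (hS : Efimov.IsLeftEndpoint (Efimov.essentialSpectrum (Efimov.opT u v k₁ k₂)) β) :
    Efimov.HasLeftEfimovEffect (Efimov.opT u v k₁ k₂) β := by
  open Efimov in
  have hβ0 : β < 0 := by
    rcases neg_or_eq_zero_of_mem_discreteSpectrum hv hv0 hK₂ hβ with h | ⟨rfl, h⟩
    · exact h
    · have := finiteDimensional_of_zero_mem_discreteSpectrum h hK₂ hβ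
      exact absurd (finite_discreteSpectrum _) hH₁
  obtain ⟨xM, hM⟩ := exists_forall_le u
  obtain ⟨yN, hN⟩ := exists_forall_le v
  have hτ := isHilbertTensor_tensor
  have hA := isSymmetric_opH (v := u) hK₁
  have hB := isSymmetric_opH (v := v) hK₂
  -- Since `v` is continuous with a zero, the numbers `l + v y` fill `[l, l + max v]`, which is
  -- therefore contained in the spectrum of `T`.
  have hTA : ∀ l < β, IsEigenvalue (opH u k₁) l → l + v yN < β := fun l hlβ hl => by
    refine lt_of_isLeftEndpoint hS (fun t ht => ?_) hlβ
    obtain ⟨y, hy⟩ := Icc_subset_range hv0 yN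
      (show t - l ∈ Icc 0 (v yN) from ⟨by linarith [ht.1], by linarith [ht.2]⟩)
    have := hτ.add_mem_spectrum hB (opT_tensor u v k₁ k₂) hl (mem_spectrum_opH (v := v) y)
    rwa [hy, add_sub_cancel] at this
  have hTB : ∀ l < β, IsEigenvalue (opH v k₂) l → l + u xM < β := fun l hlβ hl => by
    refine lt_of_isLeftEndpoint hS (fun t ht => ?_) hlβ
    obtain ⟨x, hx⟩ := Icc_subset_range hu0 xM
      (show t - l ∈ Icc 0 (u xM) from ⟨by linarith [ht.1], by linarith [ht.2]⟩)
    have := hτ.flip.add_mem_spectrum (T := opT u v k₁ k₂) hA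
      (fun a b => by rw [LinearMap.flip_apply, opT_tensor, add_comm]; rfl) hl
      (mem_spectrum_opH (v := u) x)
    rwa [hx, add_sub_cancel] at this
  obtain ⟨δA, hδA, hgA⟩ :=
    exists_pos_notMem_Icc (nonempty_lowerEigenfamily_opH hu hK₁ hβ0).some hTA
  obtain ⟨δB, hδB, hgB⟩ :=
    exists_pos_notMem_Icc (nonempty_lowerEigenfamily_opH hv hK₂ hβ0).some hTB
  have hβess : β ∈ essentialSpectrum (opT u v k₁ k₂) := connectedComponentIn_subset _ _ hS.1
  have hδ : 0 < min δA δB := lt_min hδA hδB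
  refine ⟨hβess, ⟨min δA δB, hδ, Subset.antisymm ?_ ?_⟩, ?_⟩
  · rintro E ⟨hE, hEess⟩
    by_contra hne
    have hEβ : E < β := lt_of_le_of_ne hE.2 hne
    rw [opT_eq] at hEess
    -- Segments starting at or right of `β` cannot contain `E < β`; those starting left of it stop
    -- before `β - min δA δB`.
    refine hτ.notMem_essentialSpectrum hA hB (leftOp_tensor u k₁) (rightOp_tensor v k₂)
      (fun c hc => nonempty_lowerEigenfamily_opH hu hK₁ hc)
      (fun c hc => nonempty_lowerEigenfamily_opH hv hK₂ hc)
      (re_inner_opH_le hK₁ hM) (re_inner_opH_le hK₂ hN) (hEβ.trans hβ0)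
      (fun l _ hl => hgA E ⟨?_, hEβ⟩ l hl) (fun l _ hl => hgB E ⟨?_, hEβ⟩ l hl) hEess
    · linarith [hE.1, min_le_left δA δB]
    · linarith [hE.1, min_le_right δA δB]
  · rintro _ rfl
    exact ⟨⟨by linarith, le_rfl⟩, hβess⟩
  · have hex : ∀ n : ℕ, ∃ l, IsEigenvalue (opH u k₁) l ∧ -(1 / ((n : ℝ) + 1)) < l ∧ l < 0 :=
      fun n => exists_isEigenvalue_near_zero hu hu0 hK₁ hH₁
        (neg_neg_of_pos Nat.one_div_pos_of_nat)
    choose lam hlam hlow hneg using hex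
    refine ⟨fun n => lam n + β, fun n => ⟨?_, by linarith [hneg n]⟩, ?_⟩
    · obtain ⟨φ, hφ0, hφ⟩ := hlam n
      obtain ⟨ψ, hψ0, hψ⟩ := hβ.1
      refine ⟨tensor φ ψ, ?_, ?_⟩
      · rw [← norm_ne_zero_iff, hτ.norm_apply]
        exact mul_ne_zero (norm_ne_zero_iff.2 hφ0) (norm_ne_zero_iff.2 hψ0)
      · rw [opT_tensor, hφ, hψ, map_smul, map_smul, LinearMap.smul_apply, Complex.ofReal_add,
          add_smul]
    · have h1 : Tendsto (fun n : ℕ => -(1 / ((n : ℝ) + 1))) atTop (𝓝 0) := by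
        simpa using (tendsto_one_div_add_atTop_nhds_zero_nat (𝕜 := ℝ)).neg
      have h2 : Tendsto lam atTop (𝓝 0) :=
        tendsto_of_tendsto_of_tendsto_of_le_of_le h1 tendsto_const_nhds
          (fun n => (hlow n).le) fun n => (hneg n).le
      simpa using h2.add_const β
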